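/- Let $N>1$ and $d$ be integers and let $(C_1,\dots,C_N)$ be a random element of $M(d\times d,\mathbb R)^N$ (the $C_i$ may be dependent). Write $|\cdot|$ for the Euclidean norm on $\mathbb R^d$ and $\|\cdot\|$ for the associated operator norm. Let $C=C_I$ with $I$ uniform on $\{1,\dots,N\}$ and independent of $(C_1,\dots,C_N)$, and let $\Pi_n$ be the product of $n$ independent copies of $C$. Put $$ s_\infty=\sup\{s>0:\mathbb E\|C\|^s<\infty\},\qquad m(s)=N\lim_{n\to\infty}\big(\mathbb E\|\Pi_n\|^s\big)^{1/n}\quad(0<s<s_\infty), $$ $$ \alpha=\inf\{s\in(0,s_\infty): m(s)\le 1\},\qquad \beta=\sup\{s\in(0,s_\infty): m(s)\le 1\}\in[0,\infty]. $$ Assume $\alpha<\beta$ and, more precisely, that $m(s)<1$ for some $s\in(\alpha,\beta)$. Let $r\in\mathbb R^d$ satisfy $r=N\,\mathbb E[C]\,r$ and, if $r\ne0$, assume $\beta>1$. Consider the homogeneous equation $$ R\overset{d}{=}\sum_{i=1}^N C_iR_i ,\qquad (\ast)$$ where $R_1,\dots,R_N$ are i.i.d. copies of $R$, independent of $(C_1,\dots,C_N)$.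 Solutions are understood as laws, and uniqueness is uniqueness of the law. (a) If $\alpha<\min\{2,s_\infty\}$, then there is exactly one solution $R$ of $(\ast)$ with $\mathbb E|R|<\infty$, $\mathbb E R=r$ and $\mathbb E|R|^s<\infty$ for all $0<s<\min\{s_\infty,\beta\}$. Moreover, $R=0$ almost surely if and only if $r=0$. (b) If $\alpha=2<s_\infty$ and $\Sigma$ is a symmetric positive definite $d\times d$ matrix with $$\Sigma=N\,\mathbb E\big[C\Sigma C^\top\big]+\operatorname{Cov}\big((C_1+\dots+C_N)\,r\big),$$ which for $r=0$ reads $\Sigma=N\,\mathbb E[C\Sigma C^\top]$, then there is exactly one solution $R$ of $(\ast)$ with $\mathbb E|R|<\infty$, $\mathbb E R=r$, $\operatorname{Cov}(R)=\Sigma$ and $\mathbb E|R|^s<\infty$ for all $0<s<\min\{s_\infty,\beta\}$. -/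

import Mathlib

open MeasureTheory ProbabilityTheory Filter Topology Set
open scoped ENNReal Matrix Matrix.Norms.L2Operator

noncomputable section

namespace SmoothingTransform

variable {d N : ℕ} {Ω : Type*} [MeasurableSpace Ω]

/-- Matrices carry the product `σ`-algebra of their entries, which is the Borel `σ`-algebra. -/
instance : MeasurableSpace (Matrix (Fin d) (Fin d) ℝ) :=
  inferInstanceAs (MeasurableSpace (Fin d → Fin d → ℝ))

/-- The matrix `A` applied to the column vector `x` of the Euclidean space `ℝ^d`. -/
def act (A : Matrix (Fin d) (Fin d) ℝ) (x : EuclideanSpace ℝ (Fin d)) :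
    EuclideanSpace ℝ (Fin d) :=
  WithLp.toLp 2 (A *ᵥ x.ofLp)

/-- The homogeneous smoothing transform: `transform μ C ρ` is the law of `∑ i, C_i X_i`, where
`(C_1, …, C_N)` is defined on the probability space `(Ω, μ)` and `X_1, …, X_N` are i.i.d. with
law `ρ` and independent of `(C_1, …, C_N)`. -/
def transform (μ : Measure Ω) (C : Fin N → Ω → Matrix (Fin d) (Fin d) ℝ)
    (ρ : Measure (EuclideanSpace ℝ (Fin d))) : Measure (EuclideanSpace ℝ (Fin d)) :=
  (μ.prod (Measure.pi fun _ : Fin N => ρ)).map fun p => ∑ i, act (C i p.1) (p.2 i)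

/-- The law of `C = C_I`, where the index `I` is uniform on the `N` indices and independent of
`(C_1, …, C_N)`: the equal-weight mixture of the laws of the `C_i`. -/
def genericLaw (μ : Measure Ω) (C : Fin N → Ω → Matrix (Fin d) (Fin d) ℝ) :
    Measure (Matrix (Fin d) (Fin d) ℝ) :=
  (N : ℝ≥0∞)⁻¹ • ∑ i, μ.map (C i)

/-- `E ‖Π_n‖^s` in `[0, ∞]`, where `Π_n` is the product of `n` independent matrices with law `ν`
and `‖·‖` is the operator norm associated with the Euclidean norm. -/
def productMoment (ν : Measure (Matrix (Fin d) (Fin d) ℝ)) (n : ℕ) (s : ℝ) : ℝ≥0∞ :=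
  ∫⁻ A, ‖(List.ofFn A).prod‖ₑ ^ s ∂(Measure.pi fun _ : Fin n => ν)

/-- `m(s) = N lim_n (E ‖Π_n‖^s)^{1/n}`. For `E ‖C‖^s < ∞` the limit exists because
`n ↦ E ‖Π_n‖^s` is submultiplicative, so that it coincides with the upper limit. -/
def m (μ : Measure Ω) (C : Fin N → Ω → Matrix (Fin d) (Fin d) ℝ) (s : ℝ) : ℝ≥0∞ :=
  N * limsup (fun n : ℕ => productMoment (genericLaw μ C) n s ^ (1 / (n : ℝ))) atTop

/-- `s_∞ = sup {s > 0 : E ‖C‖^s < ∞}`, in `[0, ∞]`. -/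
def sInfty (μ : Measure Ω) (C : Fin N → Ω → Matrix (Fin d) (Fin d) ℝ) : ℝ≥0∞ :=
  sSup {t | ∃ s : ℝ, 0 < s ∧ ∫⁻ A, ‖A‖ₑ ^ s ∂(genericLaw μ C) < ∞ ∧ t = ENNReal.ofReal s}

/-- The set `{s > 0 : m(s) ≤ 1}`, where `m` is considered on its domain `(0, s_∞)` only. -/
def sublevel (μ : Measure Ω) (C : Fin N → Ω → Matrix (Fin d) (Fin d) ℝ) : Set ℝ≥0∞ :=
  {t | ∃ s : ℝ, 0 < s ∧ ENNReal.ofReal s < sInfty μ C ∧ m μ C s ≤ 1 ∧ t = ENNReal.ofReal s}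

/-- `α = inf {s > 0 : m(s) ≤ 1}`, in `[0, ∞]`. -/
def alpha (μ : Measure Ω) (C : Fin N → Ω → Matrix (Fin d) (Fin d) ℝ) : ℝ≥0∞ :=
  sInf (sublevel μ C)

/-- `β = sup {s > 0 : m(s) ≤ 1}`, in `[0, ∞]`. -/
def beta (μ : Measure Ω) (C : Fin N → Ω → Matrix (Fin d) (Fin d) ℝ) : ℝ≥0∞ :=
  sSup (sublevel μ C)

/-- The expectation of a random matrix with law `ν`, entry by entry. -/
def meanMatrix (ν : Measure (Matrix (Fin d) (Fin d) ℝ)) : Matrix (Fin d) (Fin d) ℝ :=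
  Matrix.of fun i j => ∫ A, A i j ∂ν

/-- The vector `r` satisfies `r = N E[C] r`. -/
def EigenvalueEq (μ : Measure Ω) (C : Fin N → Ω → Matrix (Fin d) (Fin d) ℝ)
    (r : EuclideanSpace ℝ (Fin d)) : Prop :=
  r = (N : ℝ) • act (meanMatrix (genericLaw μ C)) r

/-- The covariance matrix of an `ℝ^d`-valued random vector `X` on `(Ω, μ)`. -/
def covMatrix (μ : Measure Ω) (X : Ω → EuclideanSpace ℝ (Fin d)) : Matrix (Fin d) (Fin d) ℝ :=
  Matrix.of fun i j => covariance (fun ω => X ω i) (fun ω => X ω j) μ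

/-- The equation `Σ = N E[C Σ Cᵀ] + Cov((C_1 + ⋯ + C_N) r)` for the covariance matrix of a
solution with expectation `r`. The last term vanishes if `r = 0`. -/
def CovarianceEq (μ : Measure Ω) (C : Fin N → Ω → Matrix (Fin d) (Fin d) ℝ)
    (r : EuclideanSpace ℝ (Fin d)) (S : Matrix (Fin d) (Fin d) ℝ) : Prop :=
  S = (N : ℝ) • (Matrix.of fun i j => ∫ A, (A * S * Aᵀ) i j ∂(genericLaw μ C))
    + covMatrix μ fun ω => ∑ k, act (C k ω) r

/-- The law `ρ` of `R` solves `R =_d ∑ i, C_i R_i`, has expectation `E R = r` and satisfies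
`E |R|^s < ∞` for all `0 < s < min {s_∞, β}`. -/
structure IsSolution (μ : Measure Ω) (C : Fin N → Ω → Matrix (Fin d) (Fin d) ℝ)
    (r : EuclideanSpace ℝ (Fin d)) (ρ : Measure (EuclideanSpace ℝ (Fin d))) : Prop where
  isProbabilityMeasure : IsProbabilityMeasure ρ
  fixed : transform μ C ρ = ρ
  integrable : Integrable id ρ
  mean : ∫ x, x ∂ρ = r
  moment : ∀ s : ℝ, 0 < s → ENNReal.ofReal s < min (sInfty μ C) (beta μ C) →
    ∫⁻ x, ‖x‖ₑ ^ s ∂ρ < ∞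

end SmoothingTransform

end

noncomputable section

namespace SmoothingTransform

variable {d N : ℕ} {Ω : Type*} [MeasurableSpace Ω]

/-! The proof works with characteristic functions and the Fourier distance of order `p`, the best
`c` with `|φ_ρ(u) - φ_ρ'(u)| ≤ c |u|^p`. Conditionally on the matrices, the transform replaces
`φ(u)` by `∏ φ(C_iᵀ u)`, and a difference of products of numbers in the unit disc is at most the sum
of the differences. After `n` steps the distance has been multiplied by at most `N^n E ‖Π_n‖^p`
(`enorm_charFun_iterate_sub_le`). By Hölder's inequality `m` is log-convex, so one strict value
`m(s) < 1` makes these factors summable for every `p` in `(α, β)` (`tsum_scaledMoment_ne_top`).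

Two laws are at finite distance of order `p` once their moments of integer order below `p` agree.
For `p ≤ 1` this says nothing, for `1 < p ≤ 2` it concerns the mean, for `2 < p ≤ 3` also the
covariance. Since `α < 2` or `α = 2`, a suitable `p` in `(α, β)` lies below `2` or in `(2, 3)`, and
uniqueness follows (`eq_of_fixed_of_momentsMatch`).

For existence the transform is iterated from `δ_r` or from a Gaussian law with mean `r` and
covariance `Σ`. The equations for `r` and `Σ` say that one step preserves the relevant moments, so
the characteristic functions are Cauchy, and Lévy's continuity theorem gives a fixed point
(`exists_fixed_of_momentsMatch`). Its moments of order `s < β` need a separate argument. The Fourier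
bound controls the first moments of the iterates uniformly. Then `E|BR|^s`, as a function of the
matrix `B`, satisfies the same kind of recursion as the Fourier distance, up to cross terms of lower
order which are absorbed (`exists_lintegral_iterate_le`). The Fourier bound also forces the limit to
have the prescribed mean and covariance. -/

instance : BorelSpace (Matrix (Fin d) (Fin d) ℝ) :=
  ⟨(Pi.borelSpace (X := fun _ : Fin d => Fin d → ℝ)).measurable_eq⟩

instance : SecondCountableTopology (Matrix (Fin d) (Fin d) ℝ) :=
  inferInstanceAs (SecondCountableTopology (Fin d → Fin d → ℝ))

/-! ### Matrices acting on Euclidean space. -/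

lemma act_eq_toEuclideanCLM (A : Matrix (Fin d) (Fin d) ℝ) (x : EuclideanSpace ℝ (Fin d)) :
    act A x = Matrix.toEuclideanCLM (n := Fin d) (𝕜 := ℝ) A x := rfl

lemma norm_act_le (A : Matrix (Fin d) (Fin d) ℝ) (x : EuclideanSpace ℝ (Fin d)) :
    ‖act A x‖ ≤ ‖A‖ * ‖x‖ :=
  Matrix.l2_opNorm_mulVec A x

lemma enorm_act_le (A : Matrix (Fin d) (Fin d) ℝ) (x : EuclideanSpace ℝ (Fin d)) :
    ‖act A x‖ₑ ≤ ‖A‖ₑ * ‖x‖ₑ := by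
  simp only [enorm]
  exact_mod_cast norm_act_le A x

lemma enorm_matrix_mul_le (A B : Matrix (Fin d) (Fin d) ℝ) : ‖A * B‖ₑ ≤ ‖A‖ₑ * ‖B‖ₑ := by
  simp only [enorm]
  exact_mod_cast nnnorm_mul_le A B

lemma act_mul (A B : Matrix (Fin d) (Fin d) ℝ) (x : EuclideanSpace ℝ (Fin d)) :
    act (A * B) x = act A (act B x) := by
  simp [act]

lemma act_one (x : EuclideanSpace ℝ (Fin d)) : act 1 x = x := by simp [act]

lemma act_sum {ι : Type*} (A : Matrix (Fin d) (Fin d) ℝ) (t : Finset ι)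
    (x : ι → EuclideanSpace ℝ (Fin d)) : act A (∑ i ∈ t, x i) = ∑ i ∈ t, act A (x i) := by
  simp only [act_eq_toEuclideanCLM, map_sum]

lemma inner_act (A : Matrix (Fin d) (Fin d) ℝ) (x u : EuclideanSpace ℝ (Fin d)) :
    inner ℝ (act A x) u = inner ℝ x (act Aᵀ u) := by
  simp only [act, EuclideanSpace.inner_eq_star_dotProduct, star_trivial]
  rw [Matrix.dotProduct_mulVec, Matrix.mulVec_transpose]

lemma enorm_transpose (A : Matrix (Fin d) (Fin d) ℝ) : ‖Aᵀ‖ₑ = ‖A‖ₑ := by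
  rw [← ofReal_norm, ← ofReal_norm, ← Matrix.conjTranspose_eq_transpose_of_trivial,
    Matrix.l2_opNorm_conjTranspose]

lemma continuous_act : Continuous fun p : Matrix (Fin d) (Fin d) ℝ × EuclideanSpace ℝ (Fin d) =>
    act p.1 p.2 := by
  unfold act
  refine (PiLp.continuous_toLp 2 _).comp ?_
  exact continuous_fst.matrix_mulVec ((PiLp.continuous_ofLp 2 _).comp continuous_snd)

@[fun_prop]
lemma measurable_act {X : Type*} [MeasurableSpace X] {A : X → Matrix (Fin d) (Fin d) ℝ}
    {x : X → EuclideanSpace ℝ (Fin d)} (hA : Measurable A) (hx : Measurable x) :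
    Measurable fun y => act (A y) (x y) :=
  continuous_act.measurable.comp (hA.prodMk hx)

@[fun_prop]
lemma measurable_prod_ofFn (j : ℕ) :
    Measurable fun A : Fin j → Matrix (Fin d) (Fin d) ℝ => (List.ofFn A).prod := by
  induction j with
  | zero => simp
  | succ j ih =>
    simp only [List.ofFn_succ, List.prod_cons]
    exact (measurable_pi_apply 0).mul
      (ih.comp (measurable_pi_lambda _ fun i => measurable_pi_apply i.succ))

/-! ### Moments of matrix products and affine recursions over matrices. -/

/-- The expectation `N^j E ‖B Π_j‖^s`. -/
def weight (N : ℕ) (ν : Measure (Matrix (Fin d) (Fin d) ℝ)) (s : ℝ) (j : ℕ)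
    (B : Matrix (Fin d) (Fin d) ℝ) : ℝ≥0∞ :=
  N ^ j * ∫⁻ A, ‖B * (List.ofFn A).prod‖ₑ ^ s ∂(Measure.pi fun _ : Fin j => ν)

/-- The sequence `N^j E ‖Π_j‖^s`, whose `j`-th root converges to `m(s)`. -/
def scaledMoment (N : ℕ) (ν : Measure (Matrix (Fin d) (Fin d) ℝ)) (s : ℝ) (j : ℕ) : ℝ≥0∞ :=
  N ^ j * productMoment ν j s

lemma weight_zero (ν : Measure (Matrix (Fin d) (Fin d) ℝ)) (s : ℝ)
    (B : Matrix (Fin d) (Fin d) ℝ) : weight N ν s 0 B = ‖B‖ₑ ^ s := by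
  simp [weight]

lemma weight_one (ν : Measure (Matrix (Fin d) (Fin d) ℝ)) (s : ℝ) (j : ℕ) :
    weight N ν s j 1 = scaledMoment N ν s j := by
  simp [weight, scaledMoment, productMoment]

lemma measurable_weight (ν : Measure (Matrix (Fin d) (Fin d) ℝ)) [IsProbabilityMeasure ν] (s : ℝ)
    (j : ℕ) : Measurable (weight N ν s j) := by
  refine Measurable.const_mul ?_ _
  refine Measurable.lintegral_prod_right' (f := fun p : Matrix (Fin d) (Fin d) ℝ ×
    (Fin j → Matrix (Fin d) (Fin d) ℝ) => ‖p.1 * (List.ofFn p.2).prod‖ₑ ^ s) ?_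
  have : Measurable fun p : Matrix (Fin d) (Fin d) ℝ × (Fin j → Matrix (Fin d) (Fin d) ℝ) =>
    (List.ofFn p.2).prod := (measurable_prod_ofFn j).comp measurable_snd
  exact ((measurable_fst.mul this).enorm).pow_const s

lemma weight_le (ν : Measure (Matrix (Fin d) (Fin d) ℝ)) {s : ℝ} (hs : 0 ≤ s) (j : ℕ)
    (B : Matrix (Fin d) (Fin d) ℝ) : weight N ν s j B ≤ ‖B‖ₑ ^ s * scaledMoment N ν s j := by
  rw [weight, scaledMoment, productMoment, mul_left_comm]
  gcongr
  rw [← lintegral_const_mul _ (by fun_prop)]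
  refine lintegral_mono fun A => ?_
  rw [← ENNReal.mul_rpow_of_nonneg _ _ hs]
  exact ENNReal.rpow_le_rpow (enorm_matrix_mul_le _ _) hs

/-- The first factor of the product is integrated last and absorbed into `B`; the other `j` factors
form a copy of `Π_j`. -/
lemma weight_succ (ν : Measure (Matrix (Fin d) (Fin d) ℝ)) [IsProbabilityMeasure ν] (s : ℝ)
    (j : ℕ) (B : Matrix (Fin d) (Fin d) ℝ) :
    weight N ν s (j + 1) B = N * ∫⁻ A, weight N ν s j (B * A) ∂ν := by
  have h := measurePreserving_piFinSuccAbove (fun _ : Fin (j + 1) => ν) 0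
  have hm : Measurable fun p : Matrix (Fin d) (Fin d) ℝ × (Fin j → Matrix (Fin d) (Fin d) ℝ) =>
      ‖B * p.1 * (List.ofFn p.2).prod‖ₑ ^ s := by
    have : Measurable fun p : Matrix (Fin d) (Fin d) ℝ × (Fin j → Matrix (Fin d) (Fin d) ℝ) =>
      (List.ofFn p.2).prod := (measurable_prod_ofFn j).comp measurable_snd
    exact (((measurable_fst.const_mul B).mul this).enorm).pow_const s
  have key : ∫⁻ A, ‖B * (List.ofFn A).prod‖ₑ ^ s ∂(Measure.pi fun _ : Fin (j + 1) => ν) =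
      ∫⁻ A, ∫⁻ A', ‖B * A * (List.ofFn A').prod‖ₑ ^ s ∂(Measure.pi fun _ : Fin j => ν) ∂ν := by
    rw [← lintegral_prod _ hm.aemeasurable, ← h.lintegral_comp hm]
    refine lintegral_congr fun A => ?_
    rw [List.ofFn_succ, List.prod_cons, mul_assoc]
    rfl
  simp only [weight]
  rw [lintegral_const_mul, key, pow_succ']
  · ring
  · exact hm.lintegral_prod_right'

lemma scaledMoment_succ_le (ν : Measure (Matrix (Fin d) (Fin d) ℝ)) [IsProbabilityMeasure ν]
    {s : ℝ} (hs : 0 ≤ s) (j : ℕ) :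
    scaledMoment N ν s (j + 1) ≤ N * (∫⁻ A, ‖A‖ₑ ^ s ∂ν) * scaledMoment N ν s j := by
  rw [← weight_one, weight_succ, mul_assoc]
  gcongr
  rw [← lintegral_mul_const _ (by fun_prop)]
  refine lintegral_mono fun A => ?_
  rw [one_mul]
  exact weight_le ν hs j A

lemma scaledMoment_ne_top (ν : Measure (Matrix (Fin d) (Fin d) ℝ)) [IsProbabilityMeasure ν]
    {s : ℝ} (hs : 0 ≤ s) (h : ∫⁻ A, ‖A‖ₑ ^ s ∂ν ≠ ∞) (j : ℕ) : scaledMoment N ν s j ≠ ∞ := by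
  induction j with
  | zero =>
    rw [← weight_one, weight_zero]
    exact ENNReal.rpow_ne_top_of_nonneg hs enorm_ne_top
  | succ j ih =>
    exact ne_top_of_le_ne_top (by finiteness) (scaledMoment_succ_le ν hs j)

/-- Many-to-one formula: the factor `N` cancels the mixture weight `1/N`, so sums over the dependent
`C_i` become integrals over a single generic matrix. -/
lemma mul_lintegral_genericLaw (hN : N ≠ 0) (μ : Measure Ω)
    {C : Fin N → Ω → Matrix (Fin d) (Fin d) ℝ} (hC : ∀ i, Measurable (C i))
    {f : Matrix (Fin d) (Fin d) ℝ → ℝ≥0∞} (hf : Measurable f) :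
    N * ∫⁻ A, f A ∂(genericLaw μ C) = ∑ i, ∫⁻ ω, f (C i ω) ∂μ := by
  rw [genericLaw, lintegral_smul_measure, lintegral_finsetSum_measure, smul_eq_mul, ← mul_assoc,
    ENNReal.mul_inv_cancel (by simpa) (by simp), one_mul]
  exact Finset.sum_congr rfl fun i _ => lintegral_map hf (hC i)

lemma isProbabilityMeasure_genericLaw (hN : N ≠ 0) (μ : Measure Ω) [IsProbabilityMeasure μ]
    {C : Fin N → Ω → Matrix (Fin d) (Fin d) ℝ} (hC : ∀ i, Measurable (C i)) :
    IsProbabilityMeasure (genericLaw μ C) := by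
  have := fun i => Measure.isProbabilityMeasure_map (μ := μ) (hC i).aemeasurable
  constructor
  simp [genericLaw, ENNReal.inv_mul_cancel, hN]

/-- Iteration of an affine recursive inequality for functions of matrices. -/
lemma le_weight_of_recursion (hN : N ≠ 0) (μ : Measure Ω) [IsProbabilityMeasure μ]
    {C : Fin N → Ω → Matrix (Fin d) (Fin d) ℝ} (hC : ∀ i, Measurable (C i)) {s : ℝ}
    {f : ℕ → Matrix (Fin d) (Fin d) ℝ → ℝ≥0∞} {g : ℕ → ℝ≥0∞} {c : ℝ≥0∞}
    (h0 : ∀ B, f 0 B ≤ c * ‖B‖ₑ ^ s)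
    (h : ∀ n B, f (n + 1) B ≤ ∑ i, ∫⁻ ω, f n (B * C i ω) ∂μ + g n * ‖B‖ₑ ^ s) (n : ℕ)
    (B : Matrix (Fin d) (Fin d) ℝ) :
    f n B ≤ c * weight N (genericLaw μ C) s n B +
      ∑ j ∈ Finset.range n, g (n - 1 - j) * weight N (genericLaw μ C) s j B := by
  have := isProbabilityMeasure_genericLaw hN μ hC
  have hw := measurable_weight (N := N) (genericLaw μ C) s
  induction n generalizing B with
  | zero => simpa [weight_zero] using h0 B
  | succ n ih =>
    have hwB : ∀ j, Measurable fun A => weight N (genericLaw μ C) s j (B * A) :=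
      fun j => (hw j).comp (measurable_id.const_mul B)
    calc f (n + 1) B ≤ ∑ i, ∫⁻ ω, f n (B * C i ω) ∂μ + g n * ‖B‖ₑ ^ s := h n B
      _ ≤ ∑ i, ∫⁻ ω, (c * weight N (genericLaw μ C) s n (B * C i ω) +
            ∑ j ∈ Finset.range n, g (n - 1 - j) * weight N (genericLaw μ C) s j (B * C i ω)) ∂μ
            + g n * ‖B‖ₑ ^ s := by
          gcongr with i _ ω
          exact ih _
      _ = N * ∫⁻ A, (c * weight N (genericLaw μ C) s n (B * A) +
            ∑ j ∈ Finset.range n, g (n - 1 - j) * weight N (genericLaw μ C) s j (B * A))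
            ∂(genericLaw μ C) + g n * ‖B‖ₑ ^ s := by
          rw [mul_lintegral_genericLaw hN μ hC (by fun_prop)]
      _ = _ := by
          -- The newest error `g n` meets no further matrix and is the term `j = 0`; every older
          -- error acquires one more factor, which shifts its index by one.
          rw [lintegral_add_left (by fun_prop), lintegral_const_mul _ (hwB n),
            lintegral_finsetSum _ (by fun_prop), Finset.sum_range_succ', mul_add, mul_left_comm,
            ← weight_succ, Finset.mul_sum, add_assoc, weight_zero]
          congr 2
          · refine Finset.sum_congr rfl fun j _ => ?_
            rw [lintegral_const_mul _ (hwB j), mul_left_comm, ← weight_succ,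
              show n + 1 - 1 - (j + 1) = n - 1 - j by omega]

lemma le_of_recursion (hN : N ≠ 0) (μ : Measure Ω) [IsProbabilityMeasure μ]
    {C : Fin N → Ω → Matrix (Fin d) (Fin d) ℝ} (hC : ∀ i, Measurable (C i)) {s : ℝ}
    {f : ℕ → Matrix (Fin d) (Fin d) ℝ → ℝ≥0∞} {c : ℝ≥0∞}
    (h0 : ∀ B, f 0 B ≤ c * ‖B‖ₑ ^ s)
    (h : ∀ n B, f (n + 1) B ≤ ∑ i, ∫⁻ ω, f n (B * C i ω) ∂μ) (n : ℕ) :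
    f n 1 ≤ c * scaledMoment N (genericLaw μ C) s n := by
  have := le_weight_of_recursion hN μ hC (g := 0) h0 (by simpa using h) n 1
  simpa [weight_one] using this

/-! ### Log-convexity of `m` and summability. -/

/-- Hölder's inequality with exponents `1/a` and `1/b`; the power `N^n` splits because `a + b = 1`.
-/
lemma scaledMoment_interpolate (ν : Measure (Matrix (Fin d) (Fin d) ℝ)) {s t a b : ℝ} (hs : 0 < s)
    (ht : 0 < t) (ha : 0 < a) (hb : 0 ≤ b) (hab : a + b = 1) (n : ℕ) :
    scaledMoment N ν (a * s + b * t) n ≤ scaledMoment N ν s n ^ a * scaledMoment N ν t n ^ b := by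
  have key : productMoment ν n (a * s + b * t) ≤
      productMoment ν n s ^ a * productMoment ν n t ^ b := by
    refine le_trans (le_of_eq ?_) (ENNReal.lintegral_mul_norm_pow_le
      (f := fun A : Fin n → Matrix (Fin d) (Fin d) ℝ => ‖(List.ofFn A).prod‖ₑ ^ s)
      (g := fun A => ‖(List.ofFn A).prod‖ₑ ^ t)
      ((measurable_prod_ofFn n).enorm.pow_const s).aemeasurable
      ((measurable_prod_ofFn n).enorm.pow_const t).aemeasurable ha.le hb hab)
    refine lintegral_congr fun A => ?_
    rw [ENNReal.rpow_add_of_nonneg _ _ (by positivity) (by positivity), mul_comm a, mul_comm b,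
      ENNReal.rpow_mul, ENNReal.rpow_mul]
  simp only [scaledMoment]
  rw [ENNReal.mul_rpow_of_nonneg _ _ ha.le, ENNReal.mul_rpow_of_nonneg _ _ hb,
    mul_mul_mul_comm]
  gcongr
  rw [← ENNReal.rpow_add_of_nonneg _ _ ha.le hb, hab, ENNReal.rpow_one]

lemma eventually_scaledMoment_le (hN : N ≠ 0) {μ : Measure Ω}
    {C : Fin N → Ω → Matrix (Fin d) (Fin d) ℝ} {s : ℝ} {θ : ℝ≥0∞} (h : m μ C s < θ) :
    ∀ᶠ n in atTop, scaledMoment N (genericLaw μ C) s n ≤ θ ^ n := by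
  have hN0 : (N : ℝ≥0∞) ≠ 0 := by simpa
  have h' : limsup (fun n : ℕ => productMoment (genericLaw μ C) n s ^ (1 / (n : ℝ))) atTop
      < θ / N := by
    rw [ENNReal.lt_div_iff_mul_lt (by simp [hN]) (by simp), mul_comm]
    exact h
  -- The index `n = 0` is discarded: there `1 / n` evaluates to `0` and the root carries no
  -- information.
  filter_upwards [eventually_lt_of_limsup_lt h', eventually_ne_atTop 0] with n hn hn0
  have hn1 : productMoment (genericLaw μ C) n s ≤ (θ / N) ^ n := by
    calc _ = (productMoment (genericLaw μ C) n s ^ (1 / (n : ℝ))) ^ (n : ℝ) := by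
          rw [← ENNReal.rpow_mul, one_div, inv_mul_cancel₀ (by exact_mod_cast hn0),
            ENNReal.rpow_one]
      _ ≤ (θ / N) ^ (n : ℝ) := ENNReal.rpow_le_rpow hn.le (by positivity)
      _ = _ := ENNReal.rpow_natCast _ _
  calc scaledMoment N (genericLaw μ C) s n ≤ N ^ n * (θ / N) ^ n := by
        rw [scaledMoment]; gcongr
    _ = θ ^ n := by rw [← mul_pow, ENNReal.mul_div_cancel hN0 (by simp)]

lemma eventually_scaledMoment_le_of_interpolate (hN : N ≠ 0) {μ : Measure Ω}
    {C : Fin N → Ω → Matrix (Fin d) (Fin d) ℝ} {s t a b : ℝ} (hs : 0 < s) (ht : 0 < t)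
    (ha : 0 < a) (hb : 0 ≤ b) (hab : a + b = 1) (hms : m μ C s < 1) (hmt : m μ C t ≤ 1) :
    ∃ q < (1 : ℝ≥0∞), ∀ᶠ n in atTop,
      scaledMoment N (genericLaw μ C) (a * s + b * t) n ≤ q ^ n := by
  obtain ⟨θ, hθ, hθ1⟩ := exists_between hms
  have hθ0 : 0 < θ := zero_le.trans_lt hθ
  have hθt : θ ≠ ∞ := (hθ1.trans ENNReal.one_lt_top).ne
  -- Since only `m(t) ≤ 1` is known, a base `η` slightly above `1` is needed at `t`. This choice
  -- leaves `θ ^ a * η ^ b = θ ^ (a * (1 - b / 2))`, still below `1`.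
  set η := θ ^ (-(a / 2)) with hη
  have hη1 : 1 < η := ENNReal.one_lt_rpow_of_pos_of_lt_one_of_neg hθ0 hθ1 (by linarith)
  refine ⟨θ ^ a * η ^ b, ?_, ?_⟩
  · rw [hη, ← ENNReal.rpow_mul, ← ENNReal.rpow_add _ _ hθ0.ne' hθt]
    exact ENNReal.rpow_lt_one hθ1 (by nlinarith)
  · filter_upwards [eventually_scaledMoment_le hN hθ,
      eventually_scaledMoment_le hN (hmt.trans_lt hη1)] with n h1 h2
    calc _ ≤ _ := scaledMoment_interpolate _ hs ht ha hb hab n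
      _ ≤ (θ ^ n) ^ a * (η ^ n) ^ b := by gcongr
      _ = (θ ^ a * η ^ b) ^ n := by
        have hpow : ∀ (x : ℝ≥0∞) (c : ℝ), (x ^ n) ^ c = (x ^ c) ^ n := fun x c => by
          rw [← ENNReal.rpow_natCast, ← ENNReal.rpow_natCast, ← ENNReal.rpow_mul,
            ← ENNReal.rpow_mul, mul_comm]
        rw [mul_pow, hpow, hpow]

lemma tsum_ne_top_of_eventually_le_pow {u : ℕ → ℝ≥0∞} (hu : ∀ n, u n ≠ ∞) {q : ℝ≥0∞} (hq : q < 1)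
    (h : ∀ᶠ n in atTop, u n ≤ q ^ n) : ∑' n, u n ≠ ∞ := by
  obtain ⟨n₀, hn₀⟩ := eventually_atTop.1 h
  rw [← ENNReal.summable.sum_add_tsum_nat_add' (k := n₀)]
  refine ENNReal.add_ne_top.2 ⟨(ENNReal.sum_lt_top.2 fun i _ => (hu i).lt_top).ne, ?_⟩
  refine ne_top_of_le_ne_top (b := (1 - q)⁻¹) ?_ ?_
  · simpa [tsub_eq_zero_iff_le] using hq
  · rw [← ENNReal.tsum_geometric]
    refine ENNReal.tsum_le_tsum fun n => (hn₀ _ (Nat.le_add_left _ _)).trans ?_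
    exact pow_le_pow_of_le_one zero_le hq.le (Nat.le_add_right _ _)

lemma rpow_le_one_add_rpow (a : ℝ≥0∞) {s t : ℝ} (hs : 0 ≤ s) (hst : s ≤ t) :
    a ^ s ≤ 1 + a ^ t := by
  rcases le_total a 1 with h | h
  · exact (ENNReal.rpow_le_one h hs).trans le_self_add
  · exact (ENNReal.rpow_le_rpow_of_exponent_le h hst).trans le_add_self

lemma lintegral_rpow_ne_top_of_le {X : Type*} [MeasurableSpace X] {κ : Measure X}
    [IsProbabilityMeasure κ] {f : X → ℝ≥0∞} {s t : ℝ} (hs : 0 ≤ s) (hst : s ≤ t)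
    (h : ∫⁻ x, f x ^ t ∂κ ≠ ∞) : ∫⁻ x, f x ^ s ∂κ ≠ ∞ := by
  refine ne_top_of_le_ne_top ?_ (lintegral_mono fun x => rpow_le_one_add_rpow (f x) hs hst)
  rw [lintegral_add_left measurable_const]
  simp [h]

lemma lintegral_enorm_rpow_genericLaw_ne_top (hN : N ≠ 0) {μ : Measure Ω} [IsProbabilityMeasure μ]
    {C : Fin N → Ω → Matrix (Fin d) (Fin d) ℝ} (hC : ∀ i, Measurable (C i)) {s : ℝ} (hs : 0 ≤ s)
    (h : ENNReal.ofReal s < sInfty μ C) : ∫⁻ A, ‖A‖ₑ ^ s ∂(genericLaw μ C) ≠ ∞ := by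
  have := isProbabilityMeasure_genericLaw hN μ hC
  obtain ⟨_, ⟨t, ht0, ht, rfl⟩, hst⟩ := lt_sSup_iff.1 h
  exact lintegral_rpow_ne_top_of_le hs ((ENNReal.ofReal_lt_ofReal_iff ht0).1 hst).le ht.ne

/-- Thus `min {s_∞, β} = β`, and `E ‖C‖^s < ∞` is automatic for `s < β`. -/
lemma beta_le_sInfty (μ : Measure Ω) (C : Fin N → Ω → Matrix (Fin d) (Fin d) ℝ) :
    beta μ C ≤ sInfty μ C := by
  refine sSup_le ?_
  rintro _ ⟨s, -, hs, -, rfl⟩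
  exact hs.le

/-- Log-convexity of `m`: the sequence `N^n E ‖Π_n‖^s` is summable if `α < s < β`. -/
lemma tsum_scaledMoment_ne_top (hN : N ≠ 0) {μ : Measure Ω} [IsProbabilityMeasure μ]
    {C : Fin N → Ω → Matrix (Fin d) (Fin d) ℝ} (hC : ∀ i, Measurable (C i))
    (hαβ : ∃ s : ℝ, alpha μ C < ENNReal.ofReal s ∧ ENNReal.ofReal s < beta μ C ∧ m μ C s < 1)
    {s : ℝ} (hαs : alpha μ C < ENNReal.ofReal s) (hsβ : ENNReal.ofReal s < beta μ C) :
    ∑' n, scaledMoment N (genericLaw μ C) s n ≠ ∞ := by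
  have := isProbabilityMeasure_genericLaw hN μ hC
  have hs : 0 < s := ENNReal.ofReal_pos.1 (zero_le.trans_lt hαs)
  obtain ⟨s₀, h0, -, hm⟩ := hαβ
  have hs₀ : 0 < s₀ := ENNReal.ofReal_pos.1 (zero_le.trans_lt h0)
  have hfin := scaledMoment_ne_top (N := N) (genericLaw μ C) hs.le
    (lintegral_enorm_rpow_genericLaw_ne_top hN hC hs.le (hsβ.trans_le (beta_le_sInfty μ C)))
  -- The exponent `s` is placed between `s₀`, where `m < 1`, and a point `t` of the sublevel set
  -- strictly beyond `s`. Strictness gives `s₀` a positive weight.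
  obtain ⟨t, ht, hmt, a, b, ha, hb, hab, rfl⟩ : ∃ t, 0 < t ∧ m μ C t ≤ 1 ∧ ∃ a b : ℝ, 0 < a ∧
      0 ≤ b ∧ a + b = 1 ∧ s = a * s₀ + b * t := by
    rcases le_total s s₀ with hle | hle
    · obtain ⟨_, ⟨t, ht0, -, hmt, rfl⟩, hts⟩ := sInf_lt_iff.1 hαs
      have hts : t < s := (ENNReal.ofReal_lt_ofReal_iff hs).1 hts
      have h1 : 0 < s₀ - t := by linarith
      refine ⟨t, ht0, hmt, (s - t) / (s₀ - t), (s₀ - s) / (s₀ - t), div_pos (by linarith) h1,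
        div_nonneg (by linarith) h1.le, ?_, ?_⟩ <;> field_simp <;> ring
    · obtain ⟨_, ⟨t, ht0, -, hmt, rfl⟩, hts⟩ := lt_sSup_iff.1 hsβ
      have hts : s < t := (ENNReal.ofReal_lt_ofReal_iff ht0).1 hts
      have h1 : 0 < t - s₀ := by linarith
      refine ⟨t, ht0, hmt, (t - s) / (t - s₀), (s - s₀) / (t - s₀), div_pos (by linarith) h1,
        div_nonneg (by linarith) h1.le, ?_, ?_⟩ <;> field_simp <;> ring
  obtain ⟨q, hq, hev⟩ := eventually_scaledMoment_le_of_interpolate hN hs₀ ht ha hb hab hm hmt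
  exact tsum_ne_top_of_eventually_le_pow hfin hq hev

/-! ### Contraction of the Fourier distance. -/

/-- Telescoping: one factor is exchanged at a time, all others being bounded by `1`. It linearizes
the products of characteristic functions produced by the transform. -/
lemma norm_prod_sub_prod_le {ι : Type*} (t : Finset ι) {a b : ι → ℂ} (ha : ∀ i, ‖a i‖ ≤ 1)
    (hb : ∀ i, ‖b i‖ ≤ 1) : ‖∏ i ∈ t, a i - ∏ i ∈ t, b i‖ ≤ ∑ i ∈ t, ‖a i - b i‖ := by
  classical
  induction t using Finset.induction_on with
  | empty => simp
  | insert i t hi ih =>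
    rw [Finset.prod_insert hi, Finset.prod_insert hi, Finset.sum_insert hi,
      show a i * ∏ j ∈ t, a j - b i * ∏ j ∈ t, b j =
        (a i - b i) * ∏ j ∈ t, a j + b i * (∏ j ∈ t, a j - ∏ j ∈ t, b j) by ring]
    have h1 : ‖∏ j ∈ t, a j‖ ≤ 1 := (Finset.norm_prod_le _ _).trans
      (Finset.prod_le_one (fun _ _ => norm_nonneg _) fun j _ => ha j)
    refine (norm_add_le _ _).trans (add_le_add ?_ ?_)
    · rw [norm_mul]
      exact mul_le_of_le_one_right (norm_nonneg _) h1
    · rw [norm_mul]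
      exact (mul_le_of_le_one_left (norm_nonneg _) (hb i)).trans ih

lemma measurable_sum_act {C : Fin N → Ω → Matrix (Fin d) (Fin d) ℝ} (hC : ∀ i, Measurable (C i)) :
    Measurable fun p : Ω × (Fin N → EuclideanSpace ℝ (Fin d)) => ∑ i, act (C i p.1) (p.2 i) := by
  fun_prop

lemma isProbabilityMeasure_transform (μ : Measure Ω) [IsProbabilityMeasure μ]
    {C : Fin N → Ω → Matrix (Fin d) (Fin d) ℝ} (hC : ∀ i, Measurable (C i))
    (ρ : Measure (EuclideanSpace ℝ (Fin d))) [IsProbabilityMeasure ρ] :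
    IsProbabilityMeasure (transform μ C ρ) :=
  Measure.isProbabilityMeasure_map (measurable_sum_act hC).aemeasurable

/-- Given the matrices, the summands `C_i R_i` are independent, and the adjoint moves each `C_i`
onto `u`. -/
lemma charFun_transform (μ : Measure Ω) [IsProbabilityMeasure μ]
    {C : Fin N → Ω → Matrix (Fin d) (Fin d) ℝ} (hC : ∀ i, Measurable (C i))
    (ρ : Measure (EuclideanSpace ℝ (Fin d))) [IsProbabilityMeasure ρ]
    (u : EuclideanSpace ℝ (Fin d)) :
    charFun (transform μ C ρ) u = ∫ ω, ∏ i, charFun ρ (act (C i ω)ᵀ u) ∂μ := by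
  have hm := measurable_sum_act hC
  rw [charFun_apply, transform, integral_map hm.aemeasurable (by fun_prop), integral_prod]
  · refine integral_congr_ae (.of_forall fun ω => ?_)
    simp only [charFun_apply]
    rw [← integral_fintype_prod_eq_prod]
    refine integral_congr_ae (.of_forall fun x => ?_)
    simp only [sum_inner, inner_act, Complex.ofReal_sum, Finset.sum_mul, Complex.exp_sum]
  · refine Integrable.of_bound (C := 1)
      (Measurable.aestronglyMeasurable (by fun_prop)) (.of_forall fun p => ?_)
    rw [Complex.norm_exp_ofReal_mul_I]

lemma measurable_charFun_act (ρ : Measure (EuclideanSpace ℝ (Fin d))) [IsProbabilityMeasure ρ]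
    {A : Ω → Matrix (Fin d) (Fin d) ℝ} (hA : Measurable A) (u : EuclideanSpace ℝ (Fin d)) :
    Measurable fun ω => charFun ρ (act (A ω)ᵀ u) := by
  have : Measurable fun ω => (A ω)ᵀ := (continuous_id.matrix_transpose.measurable).comp hA
  have h2 : Measurable (charFun ρ) := by fun_prop
  exact h2.comp (measurable_act this measurable_const)

lemma enorm_charFun_transform_sub_le (μ : Measure Ω) [IsProbabilityMeasure μ]
    {C : Fin N → Ω → Matrix (Fin d) (Fin d) ℝ} (hC : ∀ i, Measurable (C i))
    (ρ ρ' : Measure (EuclideanSpace ℝ (Fin d))) [IsProbabilityMeasure ρ] [IsProbabilityMeasure ρ']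
    (u : EuclideanSpace ℝ (Fin d)) :
    ‖charFun (transform μ C ρ) u - charFun (transform μ C ρ') u‖ₑ ≤
      ∑ i, ∫⁻ ω, ‖charFun ρ (act (C i ω)ᵀ u) - charFun ρ' (act (C i ω)ᵀ u)‖ₑ ∂μ := by
  have hm := fun (ρ : Measure (EuclideanSpace ℝ (Fin d))) [IsProbabilityMeasure ρ] i =>
    measurable_charFun_act ρ (hC i) u
  have hint : ∀ (ρ : Measure (EuclideanSpace ℝ (Fin d))) [IsProbabilityMeasure ρ],
      Integrable (fun ω => ∏ i, charFun ρ (act (C i ω)ᵀ u)) μ := fun ρ _ =>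
    Integrable.of_bound (C := 1) (Finset.measurable_prod _ fun i _ => hm ρ i).aestronglyMeasurable
      (.of_forall fun ω => (Finset.norm_prod_le _ _).trans
        (Finset.prod_le_one (fun _ _ => norm_nonneg _) fun j _ => norm_charFun_le_one _))
  rw [charFun_transform μ hC, charFun_transform μ hC, ← integral_sub (hint ρ) (hint ρ'),
    ← lintegral_finsetSum (f := fun i ω =>
      ‖charFun ρ (act (C i ω)ᵀ u) - charFun ρ' (act (C i ω)ᵀ u)‖ₑ) _
      fun i _ => ((hm ρ i).sub (hm ρ' i)).enorm]
  refine (enorm_integral_le_lintegral_enorm _).trans (lintegral_mono fun ω => ?_)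
  have := norm_prod_sub_prod_le Finset.univ (a := fun i => charFun ρ (act (C i ω)ᵀ u))
    (b := fun i => charFun ρ' (act (C i ω)ᵀ u)) (fun _ => norm_charFun_le_one _)
    (fun _ => norm_charFun_le_one _)
  rw [← ofReal_norm]
  refine (ENNReal.ofReal_le_ofReal this).trans (le_of_eq ?_)
  rw [ENNReal.ofReal_sum_of_nonneg fun _ _ => norm_nonneg _]
  simp only [ofReal_norm]

/-- The Fourier distance of order `p` is contracted by iterates of the smoothing transform. -/
lemma enorm_charFun_iterate_sub_le (hN : N ≠ 0) (μ : Measure Ω) [IsProbabilityMeasure μ]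
    {C : Fin N → Ω → Matrix (Fin d) (Fin d) ℝ} (hC : ∀ i, Measurable (C i)) {p : ℝ} (hp : 0 ≤ p)
    {ρ ρ' : ℕ → Measure (EuclideanSpace ℝ (Fin d))} [∀ n, IsProbabilityMeasure (ρ n)]
    [∀ n, IsProbabilityMeasure (ρ' n)] (hρ : ∀ n, ρ (n + 1) = transform μ C (ρ n))
    (hρ' : ∀ n, ρ' (n + 1) = transform μ C (ρ' n)) {c : ℝ≥0∞}
    (h0 : ∀ u, ‖charFun (ρ 0) u - charFun (ρ' 0) u‖ₑ ≤ c * ‖u‖ₑ ^ p) (n : ℕ)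
    (u : EuclideanSpace ℝ (Fin d)) :
    ‖charFun (ρ n) u - charFun (ρ' n) u‖ₑ ≤
      c * ‖u‖ₑ ^ p * scaledMoment N (genericLaw μ C) p n := by
  -- The difference is tracked at all points `Bᵀ u`, since one step of the transform replaces `B` by
  -- `B C_i`; only `B = 1` is kept at the end.
  have := le_of_recursion hN μ hC (s := p) (c := c * ‖u‖ₑ ^ p)
    (f := fun n B => ‖charFun (ρ n) (act Bᵀ u) - charFun (ρ' n) (act Bᵀ u)‖ₑ) (fun B => ?_)
    (fun n B => ?_) n
  · simpa [act_one] using this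
  · refine (h0 _).trans ?_
    rw [mul_assoc, ← ENNReal.mul_rpow_of_nonneg _ _ hp, mul_comm ‖u‖ₑ, ← enorm_transpose B]
    gcongr
    exact enorm_act_le _ _
  · simp only [Matrix.transpose_mul, act_mul, hρ, hρ']
    exact enorm_charFun_transform_sub_le μ hC _ _ _

/-! ### Taylor expansion of characteristic functions, matching moments, uniqueness. -/

/-- For `|x| ≤ 1` the Taylor remainder is of order `|x|^j ≤ |x|^p`. For `|x| ≥ 1` the exponential
and each of the at most three Taylor terms are bounded by `|x|^p`, whence the constant `4 = 1 + 3`.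
-/
lemma norm_exp_mul_I_sub_taylor_le {j : ℕ} (hj : j ≠ 0) (hj3 : j ≤ 3) {p : ℝ} (hp : (j : ℝ) - 1 ≤ p)
    (hpj : p ≤ j) (x : ℝ) :
    ‖Complex.exp (x * Complex.I) - ∑ m ∈ Finset.range j, (x * Complex.I) ^ m / m.factorial‖ ≤
      4 * |x| ^ p := by
  have hj1 : (1 : ℝ) ≤ j := by exact_mod_cast Nat.one_le_iff_ne_zero.2 hj
  have hp0 : 0 ≤ p := by linarith
  have hnorm : ‖(x * Complex.I : ℂ)‖ = |x| := by simp
  rcases le_total |x| 1 with hx | hx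
  · have hxp : |x| ^ j ≤ |x| ^ p := by
      rcases eq_or_lt_of_le (abs_nonneg x) with h0 | h0
      · rw [← h0, zero_pow hj]
        positivity
      · rw [← Real.rpow_natCast]
        exact Real.rpow_le_rpow_of_exponent_ge h0 hx hpj
    refine (Complex.exp_bound (hnorm.trans_le hx) (Nat.pos_of_ne_zero hj)).trans ?_
    rw [hnorm, mul_comm]
    have h2 : ((j.succ : ℝ) * ((j.factorial : ℝ) * j)⁻¹) ≤ 4 := by
      interval_cases j <;> first | exact absurd rfl hj | norm_num [Nat.factorial]
    gcongr
  · have hsum : ‖∑ m ∈ Finset.range j, (x * Complex.I) ^ m / m.factorial‖ ≤ 3 * |x| ^ p := by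
      refine (norm_sum_le _ _).trans ?_
      calc _ ≤ ∑ m ∈ Finset.range j, |x| ^ p := by
            refine Finset.sum_le_sum fun m hm => ?_
            have hm' : (m : ℝ) ≤ p := by
              have : (m : ℝ) + 1 ≤ j := by exact_mod_cast Finset.mem_range.1 hm
              linarith
            rw [norm_div, norm_pow, hnorm, Complex.norm_natCast]
            refine (div_le_self (by positivity)
              (by exact_mod_cast Nat.one_le_iff_ne_zero.2 m.factorial_ne_zero)).trans ?_
            rw [← Real.rpow_natCast]
            exact Real.rpow_le_rpow_of_exponent_le hx hm'
        _ = j * |x| ^ p := by simp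
        _ ≤ 3 * |x| ^ p := by
            gcongr
            exact_mod_cast hj3
    calc _ ≤ 1 + 3 * |x| ^ p := by
          refine (norm_sub_le _ _).trans (add_le_add ?_ hsum)
          rw [Complex.norm_exp_ofReal_mul_I]
      _ ≤ 4 * |x| ^ p := by linarith [Real.one_le_rpow hx hp0]

/-- The moments of order less than `j` of `ρ` and `ρ'` agree in every direction. -/
def MomentsMatch (j : ℕ) (ρ ρ' : Measure (EuclideanSpace ℝ (Fin d))) : Prop :=
  ∀ m < j, ∀ u, ∫ x, inner ℝ x u ^ m ∂ρ = ∫ x, inner ℝ x u ^ m ∂ρ'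

lemma MomentsMatch.mono {i j : ℕ} (hij : i ≤ j) {ρ ρ' : Measure (EuclideanSpace ℝ (Fin d))}
    (h : MomentsMatch j ρ ρ') : MomentsMatch i ρ ρ' :=
  fun m hm => h m (hm.trans_le hij)

lemma enorm_inner_le (x u : EuclideanSpace ℝ (Fin d)) : ‖inner ℝ x u‖ₑ ≤ ‖x‖ₑ * ‖u‖ₑ := by
  simp only [enorm]
  exact_mod_cast norm_inner_le_norm x u

lemma integrable_inner_pow (ρ : Measure (EuclideanSpace ℝ (Fin d))) [IsProbabilityMeasure ρ]
    {p : ℝ} (h : ∫⁻ x, ‖x‖ₑ ^ p ∂ρ ≠ ∞) {m : ℕ} (hm : (m : ℝ) ≤ p)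
    (u : EuclideanSpace ℝ (Fin d)) : Integrable (fun x => inner ℝ x u ^ m) ρ := by
  refine ⟨Measurable.aestronglyMeasurable (by fun_prop), ?_⟩
  have hfin := lintegral_rpow_ne_top_of_le (Nat.cast_nonneg m) hm h
  calc ∫⁻ x, ‖inner ℝ x u ^ m‖ₑ ∂ρ ≤ ∫⁻ x, ‖x‖ₑ ^ (m : ℝ) * ‖u‖ₑ ^ m ∂ρ := by
        refine lintegral_mono fun x => ?_
        rw [enorm_pow, ENNReal.rpow_natCast, ← mul_pow]
        gcongr
        exact enorm_inner_le x u
    _ < ∞ := by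
        rw [lintegral_mul_const _ (by fun_prop)]
        exact (ENNReal.mul_ne_top hfin (by finiteness)).lt_top

lemma enorm_charFun_sub_taylor_le (ρ : Measure (EuclideanSpace ℝ (Fin d)))
    [IsProbabilityMeasure ρ] {j : ℕ} (hj : j ≠ 0) (hj3 : j ≤ 3) {p : ℝ} (hp : (j : ℝ) - 1 ≤ p)
    (hpj : p ≤ j) (h : ∫⁻ x, ‖x‖ₑ ^ p ∂ρ ≠ ∞) (u : EuclideanSpace ℝ (Fin d)) :
    ‖charFun ρ u - ∑ m ∈ Finset.range j,
      ((∫ x, inner ℝ x u ^ m ∂ρ : ℝ) : ℂ) * (Complex.I ^ m / m.factorial)‖ₑ ≤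
      4 * (∫⁻ x, ‖x‖ₑ ^ p ∂ρ) * ‖u‖ₑ ^ p := by
  have hp0 : 0 ≤ p := by
    have : (1 : ℝ) ≤ j := by exact_mod_cast Nat.one_le_iff_ne_zero.2 hj
    linarith
  have hint : ∀ m ∈ Finset.range j, Integrable (fun x : EuclideanSpace ℝ (Fin d) =>
      ((inner ℝ x u : ℝ) * Complex.I) ^ m / m.factorial) ρ := fun m hm => by
    have hm' : (m : ℝ) + 1 ≤ j := by exact_mod_cast Finset.mem_range.1 hm
    have := ((integrable_inner_pow ρ h (m := m) (by linarith) u).ofReal (𝕜 := ℂ)).mul_const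
      (Complex.I ^ m / m.factorial)
    refine this.congr (.of_forall fun x => ?_)
    simp only [Complex.coe_algebraMap, mul_pow, mul_div_assoc, RCLike.ofReal_pow]
  have hexp : Integrable (fun x : EuclideanSpace ℝ (Fin d) =>
      Complex.exp ((inner ℝ x u : ℝ) * Complex.I)) ρ :=
    Integrable.of_bound (C := 1) (Measurable.aestronglyMeasurable (by fun_prop))
      (.of_forall fun x => by rw [Complex.norm_exp_ofReal_mul_I])
  have hsum : ∑ m ∈ Finset.range j,
      ((∫ x, inner ℝ x u ^ m ∂ρ : ℝ) : ℂ) * (Complex.I ^ m / m.factorial) =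
      ∫ x, ∑ m ∈ Finset.range j, ((inner ℝ x u : ℝ) * Complex.I) ^ m / m.factorial ∂ρ := by
    rw [integral_finsetSum _ hint]
    refine Finset.sum_congr rfl fun m _ => ?_
    rw [← integral_complex_ofReal, ← integral_mul_const]
    refine integral_congr_ae (.of_forall fun x => ?_)
    simp only [mul_pow, mul_div_assoc, Complex.ofReal_pow]
  rw [hsum, charFun_apply, ← integral_sub hexp (integrable_finsetSum _ hint)]
  refine (enorm_integral_le_lintegral_enorm _).trans ?_
  rw [mul_assoc, ← lintegral_mul_const _ (by fun_prop), ← lintegral_const_mul _ (by fun_prop)]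
  refine lintegral_mono fun x => ?_
  have h1 := norm_exp_mul_I_sub_taylor_le hj hj3 hp hpj (inner ℝ x u)
  rw [← ofReal_norm]
  refine (ENNReal.ofReal_le_ofReal h1).trans ?_
  rw [ENNReal.ofReal_mul (by norm_num), ← ENNReal.ofReal_rpow_of_nonneg (abs_nonneg _) hp0,
    ← Real.norm_eq_abs, ofReal_norm, ← ENNReal.mul_rpow_of_nonneg _ _ hp0]
  gcongr
  · norm_num
  · exact enorm_inner_le x u

/-- Matching moments give the same Taylor polynomial, so only the two remainders survive. -/
lemma enorm_charFun_sub_le {ρ ρ' : Measure (EuclideanSpace ℝ (Fin d))}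
    [IsProbabilityMeasure ρ] [IsProbabilityMeasure ρ'] {j : ℕ} (hj : j ≠ 0) (hj3 : j ≤ 3) {p : ℝ}
    (hp : (j : ℝ) - 1 ≤ p) (hpj : p ≤ j) (h : ∫⁻ x, ‖x‖ₑ ^ p ∂ρ ≠ ∞)
    (h' : ∫⁻ x, ‖x‖ₑ ^ p ∂ρ' ≠ ∞) (hm : MomentsMatch j ρ ρ') (u : EuclideanSpace ℝ (Fin d)) :
    ‖charFun ρ u - charFun ρ' u‖ₑ ≤
      4 * (∫⁻ x, ‖x‖ₑ ^ p ∂ρ + ∫⁻ x, ‖x‖ₑ ^ p ∂ρ') * ‖u‖ₑ ^ p := by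
  have h1 := enorm_charFun_sub_taylor_le ρ hj hj3 hp hpj h u
  have h2 := enorm_charFun_sub_taylor_le ρ' hj hj3 hp hpj h' u
  have : ∑ m ∈ Finset.range j,
      ((∫ x, inner ℝ x u ^ m ∂ρ : ℝ) : ℂ) * (Complex.I ^ m / m.factorial) = ∑ m ∈ Finset.range j,
      ((∫ x, inner ℝ x u ^ m ∂ρ' : ℝ) : ℂ) * (Complex.I ^ m / m.factorial) :=
    Finset.sum_congr rfl fun m hmj => by rw [hm m (Finset.mem_range.1 hmj)]
  rw [this] at h1
  rw [mul_add, add_mul, ← sub_sub_sub_cancel_right _ _ (∑ m ∈ Finset.range j,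
      ((∫ x, inner ℝ x u ^ m ∂ρ' : ℝ) : ℂ) * (Complex.I ^ m / m.factorial))]
  exact enorm_sub_le.trans (add_le_add h1 h2)

/-- Uniqueness of fixed points with prescribed moments of low order. -/
lemma eq_of_fixed_of_momentsMatch (hN : N ≠ 0) (μ : Measure Ω) [IsProbabilityMeasure μ]
    {C : Fin N → Ω → Matrix (Fin d) (Fin d) ℝ} (hC : ∀ i, Measurable (C i)) {j : ℕ} (hj : j ≠ 0)
    (hj3 : j ≤ 3) {p : ℝ} (hp : (j : ℝ) - 1 ≤ p) (hpj : p ≤ j)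
    (hsum : ∑' n, scaledMoment N (genericLaw μ C) p n ≠ ∞)
    {ρ ρ' : Measure (EuclideanSpace ℝ (Fin d))} [IsProbabilityMeasure ρ] [IsProbabilityMeasure ρ']
    (hρ : transform μ C ρ = ρ) (hρ' : transform μ C ρ' = ρ') (h : ∫⁻ x, ‖x‖ₑ ^ p ∂ρ ≠ ∞)
    (h' : ∫⁻ x, ‖x‖ₑ ^ p ∂ρ' ≠ ∞) (hm : MomentsMatch j ρ ρ') : ρ = ρ' := by
  have hp0 : 0 ≤ p := by
    have : (1 : ℝ) ≤ j := by exact_mod_cast Nat.one_le_iff_ne_zero.2 hj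
    linarith
  refine Measure.ext_of_charFun (funext fun u => ?_)
  rw [← sub_eq_zero, ← enorm_eq_zero, ← nonpos_iff_eq_zero]
  have hlim := ENNReal.Tendsto.const_mul (ENNReal.tendsto_atTop_zero_of_tsum_ne_top hsum)
    (a := 4 * (∫⁻ x, ‖x‖ₑ ^ p ∂ρ + ∫⁻ x, ‖x‖ₑ ^ p ∂ρ') * ‖u‖ₑ ^ p) (.inr (by finiteness))
  rw [mul_zero] at hlim
  refine ge_of_tendsto' hlim fun n => ?_
  -- Fixed points are constant sequences of iterates, so the same distance is bounded by a null
  -- sequence.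
  exact enorm_charFun_iterate_sub_le hN μ hC hp0 (ρ := fun _ => ρ) (ρ' := fun _ => ρ')
    (fun _ => hρ.symm) (fun _ => hρ'.symm) (enorm_charFun_sub_le hj hj3 hp hpj h h' hm) n u

/-- Divide by `t ^ m` and let `t` decrease to `0`. -/
lemma eq_zero_of_mul_pow_le_rpow {a c p : ℝ} {m : ℕ} (hmp : m < p)
    (h : ∀ t : ℝ, 0 < t → |a| * t ^ m ≤ c * t ^ p) : a = 0 := by
  have hlim : Tendsto (fun t : ℝ => c * t ^ (p - m)) (𝓝[>] 0) (𝓝 (c * 0 ^ (p - m))) :=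
    ((Real.continuousAt_rpow_const 0 (p - m) (.inr (by linarith))).tendsto.mono_left
      nhdsWithin_le_nhds).const_mul c
  rw [Real.zero_rpow (by linarith), mul_zero] at hlim
  refine abs_nonpos_iff.1 (ge_of_tendsto hlim ?_)
  filter_upwards [self_mem_nhdsWithin] with t ht
  have ht : 0 < t := ht
  rw [Real.rpow_sub ht, Real.rpow_natCast, ← mul_div_assoc, le_div_iff₀ (by positivity)]
  exact h t ht

/-- Converse of `enorm_charFun_sub_le` for `p > j - 1`: along the ray `t • u` the difference of the
Taylor polynomials is a polynomial in `t` of degree below `p` that is `O(t ^ p)`, hence zero. It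
identifies the mean and covariance of the limit law. -/
lemma momentsMatch_of_enorm_charFun_sub_le {ρ ρ' : Measure (EuclideanSpace ℝ (Fin d))}
    [IsProbabilityMeasure ρ] [IsProbabilityMeasure ρ'] {j : ℕ} (hj : j ≠ 0) (hj3 : j ≤ 3) {p : ℝ}
    (hp : (j : ℝ) - 1 < p) (hpj : p ≤ j) (h : ∫⁻ x, ‖x‖ₑ ^ p ∂ρ ≠ ∞)
    (h' : ∫⁻ x, ‖x‖ₑ ^ p ∂ρ' ≠ ∞) {c : ℝ≥0∞} (hc : c ≠ ∞)
    (hφ : ∀ u, ‖charFun ρ u - charFun ρ' u‖ₑ ≤ c * ‖u‖ₑ ^ p) : MomentsMatch j ρ ρ' := by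
  have hp0 : 0 < p := by
    have : (1 : ℝ) ≤ j := by exact_mod_cast Nat.one_le_iff_ne_zero.2 hj
    linarith
  intro m hm u
  set D : ℕ → ℝ := fun m => ∫ x, inner ℝ x u ^ m ∂ρ - ∫ x, inner ℝ x u ^ m ∂ρ' with hD
  suffices hDm : D m = 0 from sub_eq_zero.1 hDm
  have hD0 : D 0 = 0 := by simp [hD]
  set K : ℝ≥0∞ := (4 * ∫⁻ x, ‖x‖ₑ ^ p ∂ρ + 4 * ∫⁻ x, ‖x‖ₑ ^ p ∂ρ' + c) * ‖u‖ₑ ^ p with hK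
  have hKt : K ≠ ∞ := by finiteness
  have key : ∀ t : ℝ, 0 < t → ‖∑ m ∈ Finset.range j,
      ((t ^ m * D m : ℝ) : ℂ) * (Complex.I ^ m / m.factorial)‖ ≤ K.toReal * t ^ p := by
    intro t ht
    have h1 := enorm_charFun_sub_taylor_le ρ hj hj3 hp.le hpj h (t • u)
    have h2 := enorm_charFun_sub_taylor_le ρ' hj hj3 hp.le hpj h' (t • u)
    have h3 := hφ (t • u)
    have heq : ∑ m ∈ Finset.range j, ((t ^ m * D m : ℝ) : ℂ) * (Complex.I ^ m / m.factorial) =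
        -(charFun ρ (t • u) - ∑ m ∈ Finset.range j,
          ((∫ x, inner ℝ x (t • u) ^ m ∂ρ : ℝ) : ℂ) * (Complex.I ^ m / m.factorial)) +
        (charFun ρ' (t • u) - ∑ m ∈ Finset.range j,
          ((∫ x, inner ℝ x (t • u) ^ m ∂ρ' : ℝ) : ℂ) * (Complex.I ^ m / m.factorial)) +
        (charFun ρ (t • u) - charFun ρ' (t • u)) := by
      simp only [inner_smul_right, mul_pow, integral_const_mul, hD, mul_sub, Complex.ofReal_sub,
        sub_mul, Finset.sum_sub_distrib]
      ring
    have htp : ‖t • u‖ₑ ^ p = ENNReal.ofReal (t ^ p) * ‖u‖ₑ ^ p := by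
      rw [enorm_smul, ENNReal.mul_rpow_of_nonneg _ _ hp0.le, ← ofReal_norm t,
        Real.norm_of_nonneg ht.le, ENNReal.ofReal_rpow_of_nonneg ht.le hp0.le]
    rw [← enorm_neg] at h1
    have : ‖∑ m ∈ Finset.range j,
        ((t ^ m * D m : ℝ) : ℂ) * (Complex.I ^ m / m.factorial)‖ₑ ≤
        K * ENNReal.ofReal (t ^ p) := by
      rw [heq]
      refine (enorm_add_le _ _).trans ((add_le_add ((enorm_add_le _ _).trans (add_le_add h1 h2))
        h3).trans (le_of_eq ?_))
      rw [htp, hK]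
      ring
    rw [← toReal_enorm]
    refine (ENNReal.toReal_mono (by finiteness) this).trans (le_of_eq ?_)
    rw [ENNReal.toReal_mul, ENNReal.toReal_ofReal (by positivity)]
  interval_cases j
  · exact absurd rfl hj
  · interval_cases m
    exact hD0
  · interval_cases m
    · exact hD0
    · refine eq_zero_of_mul_pow_le_rpow (m := 1) (p := p) (c := K.toReal)
        (by push_cast at hp ⊢; linarith) fun t ht => ?_
      have := key t ht
      simp only [Finset.sum_range_succ, Finset.sum_range_zero, hD0] at this
      simpa [abs_of_pos ht, mul_comm] using this
  -- The powers of `I` put the second moment into the real part and the first into the imaginary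
  -- part, so each can be estimated alone.
  · have hsplit : ∀ t : ℝ, ∑ m ∈ Finset.range 3,
        ((t ^ m * D m : ℝ) : ℂ) * (Complex.I ^ m / m.factorial) =
        ⟨-(t ^ 2 * D 2 / 2), t * D 1⟩ := by
      intro t
      apply Complex.ext <;>
      simp [Finset.sum_range_succ, hD0, Nat.factorial, -Complex.ofReal_pow,
        -Complex.ofReal_mul]
      ring
    interval_cases m
    · exact hD0
    · refine eq_zero_of_mul_pow_le_rpow (m := 1) (p := p) (c := K.toReal)
        (by push_cast at hp ⊢; linarith) fun t ht => ?_
      have := (Complex.abs_im_le_norm _).trans (key t ht)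
      rw [hsplit] at this
      simpa [abs_mul, abs_of_pos ht, mul_comm] using this
    · refine eq_zero_of_mul_pow_le_rpow (m := 2) (p := p) (c := 2 * K.toReal)
        (by push_cast at hp ⊢; linarith) fun t ht => ?_
      have := (Complex.abs_re_le_norm _).trans (key t ht)
      rw [hsplit] at this
      simp only [abs_neg, abs_div, abs_mul, abs_pow, abs_of_pos ht, abs_two] at this
      linarith

/-! ### Moment recursion for the smoothing transform. -/

/-- The diagonal terms must have coefficient exactly `1`, so that they reproduce `N E ‖C‖^s`-type
weights; convexity alone would cost a power of `N`. Split off the largest term `a k`, use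
Bernoulli's inequality for `(x - b)^s` with `b` the sum of the others, and bound the remaining `x ^
(s - 1)` by means of `x ≤ N * a k`. -/
lemma sum_rpow_le {s : ℝ} (hs : 1 ≤ s) {a : Fin N → ℝ} (ha : ∀ i, 0 ≤ a i) :
    (∑ i, a i) ^ s ≤ ∑ i, a i ^ s +
      s * N ^ (s - 1) * ∑ i, ∑ j ∈ Finset.univ.erase i, a i ^ (s - 1) * a j := by
  have hrhs : ∀ i, 0 ≤ ∑ j ∈ Finset.univ.erase i, a i ^ (s - 1) * a j := fun i =>
    Finset.sum_nonneg fun j _ => mul_nonneg (Real.rpow_nonneg (ha i) _) (ha j)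
  rcases (Finset.sum_nonneg fun i _ => ha i : 0 ≤ ∑ i, a i).eq_or_lt with h0 | hpos
  · rw [← h0, Real.zero_rpow (by linarith)]
    exact add_nonneg (Finset.sum_nonneg fun i _ => Real.rpow_nonneg (ha i) _)
      (mul_nonneg (by positivity) (Finset.sum_nonneg fun i _ => hrhs i))
  · have hne : (Finset.univ : Finset (Fin N)).Nonempty := by
      by_contra h
      rw [Finset.not_nonempty_iff_eq_empty] at h
      simp [h] at hpos
    obtain ⟨k, -, hk⟩ := Finset.exists_max_image Finset.univ a hne
    set x := ∑ i, a i with hx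
    set b := ∑ j ∈ Finset.univ.erase k, a j with hb
    have hxab : x = a k + b := by rw [hx, hb, Finset.add_sum_erase _ _ (Finset.mem_univ k)]
    have hb0 : 0 ≤ b := Finset.sum_nonneg fun j _ => ha j
    have hxN : x ≤ N * a k := by
      calc x ≤ ∑ _i : Fin N, a k := Finset.sum_le_sum fun i hi => hk i hi
        _ = N * a k := by simp
    have hbern : x ^ s - s * b * x ^ (s - 1) ≤ a k ^ s := by
      have h1 := one_add_mul_self_le_rpow_one_add (s := -(b / x))
        (by rw [neg_le_neg_iff, div_le_one hpos]; linarith [ha k]) hs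
      have h2 : 1 + -(b / x) = a k / x := by field_simp; linarith
      rw [h2, Real.div_rpow (ha k) hpos.le, le_div_iff₀ (by positivity)] at h1
      refine le_trans (le_of_eq ?_) h1
      rw [Real.rpow_sub_one hpos.ne']
      field_simp
      ring
    have hpow : x ^ (s - 1) ≤ N ^ (s - 1) * a k ^ (s - 1) := by
      rw [← Real.mul_rpow (by positivity) (ha k)]
      exact Real.rpow_le_rpow hpos.le hxN (by linarith)
    calc x ^ s ≤ a k ^ s + s * b * x ^ (s - 1) := by linarith
      _ ≤ a k ^ s + s * b * (N ^ (s - 1) * a k ^ (s - 1)) := by gcongr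
      _ = a k ^ s + s * N ^ (s - 1) * ∑ j ∈ Finset.univ.erase k, a k ^ (s - 1) * a j := by
        rw [← Finset.mul_sum, hb]
        ring
      _ ≤ _ := by
        gcongr
        · exact Finset.single_le_sum (f := fun i => a i ^ s)
            (fun i _ => Real.rpow_nonneg (ha i) _) (Finset.mem_univ k)
        · exact Finset.single_le_sum
            (f := fun i => ∑ j ∈ Finset.univ.erase i, a i ^ (s - 1) * a j)
            (fun i _ => hrhs i) (Finset.mem_univ k)

lemma enorm_sum_rpow_le {s : ℝ} (hs : 1 ≤ s) (v : Fin N → EuclideanSpace ℝ (Fin d)) :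
    ‖∑ i, v i‖ₑ ^ s ≤ ∑ i, ‖v i‖ₑ ^ s + ENNReal.ofReal (s * N ^ (s - 1)) *
      ∑ i, ∑ j ∈ Finset.univ.erase i, ‖v i‖ₑ ^ (s - 1) * ‖v j‖ₑ := by
  have hs0 : 0 ≤ s := by linarith
  have h := (Real.rpow_le_rpow (norm_nonneg _) (norm_sum_le Finset.univ v) hs0).trans
    (sum_rpow_le hs fun i => norm_nonneg (v i))
  have h1 : ∀ i ∈ Finset.univ, 0 ≤ ‖v i‖ ^ s := fun i _ => by positivity
  have h2 : ∀ i, ∀ j ∈ Finset.univ.erase i, 0 ≤ ‖v i‖ ^ (s - 1) * ‖v j‖ :=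
    fun i j _ => by positivity
  have h3 : ∀ i ∈ Finset.univ, 0 ≤ ∑ j ∈ Finset.univ.erase i, ‖v i‖ ^ (s - 1) * ‖v j‖ :=
    fun i _ => Finset.sum_nonneg (h2 i)
  have := ENNReal.ofReal_le_ofReal h
  rw [ENNReal.ofReal_add (Finset.sum_nonneg h1)
    (mul_nonneg (by positivity) (Finset.sum_nonneg h3)), ENNReal.ofReal_mul (by positivity),
    ENNReal.ofReal_sum_of_nonneg h1, ENNReal.ofReal_sum_of_nonneg h3] at this
  simp only [fun i => ENNReal.ofReal_sum_of_nonneg (h2 i)] at this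
  simpa only [ENNReal.ofReal_mul (Real.rpow_nonneg (norm_nonneg _) _),
    ← ENNReal.ofReal_rpow_of_nonneg (norm_nonneg _) hs0,
    ← ENNReal.ofReal_rpow_of_nonneg (norm_nonneg _) (sub_nonneg.2 hs), ofReal_norm] using this

/-- Bounds the mixed moments of `C_i` and `C_j`, for which independence is not available. -/
lemma rpow_sub_one_mul_le (a b : ℝ≥0∞) {s : ℝ} (hs : 1 ≤ s) :
    a ^ (s - 1) * b ≤ a ^ s + b ^ s := by
  have hmul : ∀ c : ℝ≥0∞, c ^ (s - 1) * c = c ^ s := fun c => by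
    conv_rhs => rw [show s = (s - 1) + 1 by ring,
      ENNReal.rpow_add_of_nonneg _ _ (by linarith) zero_le_one, ENNReal.rpow_one]
  rcases le_total a b with h | h
  · exact (mul_le_mul_left (ENNReal.rpow_le_rpow h (by linarith)) b).trans
      ((hmul b).le.trans le_add_self)
  · exact (mul_le_mul_right h (a ^ (s - 1))).trans ((hmul a).le.trans le_self_add)

lemma lintegral_pi_mul (ρ : Measure (EuclideanSpace ℝ (Fin d))) [IsProbabilityMeasure ρ]
    {f g : EuclideanSpace ℝ (Fin d) → ℝ≥0∞} (hf : Measurable f) (hg : Measurable g) {i j : Fin N}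
    (hij : i ≠ j) : ∫⁻ x, f (x i) * g (x j) ∂(Measure.pi fun _ : Fin N => ρ) =
      (∫⁻ x, f x ∂ρ) * ∫⁻ x, g x ∂ρ := by
  have hind := (iIndepFun_pi (μ := fun _ : Fin N => ρ) (X := fun _ => id)
    (fun _ => aemeasurable_id)).indepFun hij
  have h := lintegral_mul_eq_lintegral_mul_lintegral_of_indepFun
    (hf.comp (measurable_pi_apply i)) (hg.comp (measurable_pi_apply j)) (hind.comp hf hg)
  have hi := measurePreserving_eval (fun _ : Fin N => ρ) i
  have hj := measurePreserving_eval (fun _ : Fin N => ρ) j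
  rw [← hi.lintegral_comp hf, ← hj.lintegral_comp hg]
  exact h

lemma lintegral_pi_eval (ρ : Measure (EuclideanSpace ℝ (Fin d))) [IsProbabilityMeasure ρ]
    {f : EuclideanSpace ℝ (Fin d) → ℝ≥0∞} (hf : Measurable f) (i : Fin N) :
    ∫⁻ x, f (x i) ∂(Measure.pi fun _ : Fin N => ρ) = ∫⁻ x, f x ∂ρ :=
  (measurePreserving_eval (fun _ : Fin N => ρ) i).lintegral_comp hf

/-- One step of the moment recursion for the smoothing transform, with a cross term of lower
order. -/
lemma exists_lintegral_transform_le (μ : Measure Ω) [IsProbabilityMeasure μ]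
    {C : Fin N → Ω → Matrix (Fin d) (Fin d) ℝ} (hC : ∀ i, Measurable (C i)) {s : ℝ} (hs : 1 ≤ s)
    (hCs : ∀ i, ∫⁻ ω, ‖C i ω‖ₑ ^ s ∂μ ≠ ∞) :
    ∃ K : ℝ≥0∞, K ≠ ∞ ∧ ∀ (ρ : Measure (EuclideanSpace ℝ (Fin d))) [IsProbabilityMeasure ρ]
      (B : Matrix (Fin d) (Fin d) ℝ), ∫⁻ x, ‖act B x‖ₑ ^ s ∂(transform μ C ρ) ≤
        ∑ i, ∫⁻ ω, ∫⁻ x, ‖act (B * C i ω) x‖ₑ ^ s ∂ρ ∂μ +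
          K * ((∫⁻ x, ‖x‖ₑ ^ (s - 1) ∂ρ) * ∫⁻ x, ‖x‖ₑ ∂ρ) * ‖B‖ₑ ^ s := by
  have hs1 : 0 ≤ s - 1 := by linarith
  set c := ENNReal.ofReal (s * N ^ (s - 1)) with hc
  set L : Fin N → Fin N → ℝ≥0∞ := fun i j => ∫⁻ ω, ‖C i ω‖ₑ ^ (s - 1) * ‖C j ω‖ₑ ∂μ with hL
  have hLt : ∀ i j, L i j ≠ ∞ := fun i j => by
    refine ne_top_of_le_ne_top ?_ (lintegral_mono fun ω => rpow_sub_one_mul_le ‖C i ω‖ₑ ‖C j ω‖ₑ hs)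
    rw [lintegral_add_left ((hC i).enorm.pow_const s)]
    exact ENNReal.add_ne_top.2 ⟨hCs i, hCs j⟩
  -- The constant involves only the mixed moments of the matrices, so one `K` serves every law `ρ`
  -- and every `B`.
  refine ⟨c * ∑ i, ∑ j ∈ Finset.univ.erase i, L i j, ENNReal.mul_ne_top ENNReal.ofReal_ne_top
    (ENNReal.sum_ne_top.2 fun i _ => ENNReal.sum_ne_top.2 fun j _ => hLt i j), fun ρ _ B => ?_⟩
  set G := (∫⁻ x, ‖x‖ₑ ^ (s - 1) ∂ρ) * ∫⁻ x, ‖x‖ₑ ∂ρ with hG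
  have hcross : ∀ i j, i ≠ j → ∀ ω,
      ∫⁻ x, ‖act (B * C i ω) (x i)‖ₑ ^ (s - 1) * ‖act (B * C j ω) (x j)‖ₑ
        ∂(Measure.pi fun _ : Fin N => ρ) ≤
      ‖B‖ₑ ^ s * G * (‖C i ω‖ₑ ^ (s - 1) * ‖C j ω‖ₑ) := by
    intro i j hij ω
    have hB : ‖B‖ₑ ^ s = ‖B‖ₑ ^ (s - 1) * ‖B‖ₑ := by
      conv_lhs => rw [show s = (s - 1) + 1 by ring,
        ENNReal.rpow_add_of_nonneg _ _ hs1 zero_le_one, ENNReal.rpow_one]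
    have hbound : ∀ k (y : EuclideanSpace ℝ (Fin d)),
        ‖act (B * C k ω) y‖ₑ ≤ ‖B‖ₑ * ‖C k ω‖ₑ * ‖y‖ₑ := fun k y =>
      (enorm_act_le _ _).trans (by gcongr; exact enorm_matrix_mul_le _ _)
    calc _ ≤ ∫⁻ x, (‖B‖ₑ ^ s * (‖C i ω‖ₑ ^ (s - 1) * ‖C j ω‖ₑ)) *
            (‖x i‖ₑ ^ (s - 1) * ‖x j‖ₑ) ∂(Measure.pi fun _ : Fin N => ρ) := by
          refine lintegral_mono fun x => ?_
          calc _ ≤ (‖B‖ₑ * ‖C i ω‖ₑ * ‖x i‖ₑ) ^ (s - 1) * (‖B‖ₑ * ‖C j ω‖ₑ * ‖x j‖ₑ) :=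
                mul_le_mul' (ENNReal.rpow_le_rpow (hbound i _) hs1) (hbound j _)
            _ = _ := by
              rw [ENNReal.mul_rpow_of_nonneg _ _ hs1, ENNReal.mul_rpow_of_nonneg _ _ hs1, hB]
              ring
      _ = _ := by
          rw [lintegral_const_mul _ (by fun_prop),
            lintegral_pi_mul ρ (f := fun x => ‖x‖ₑ ^ (s - 1)) (g := fun x => ‖x‖ₑ)
              (by fun_prop) (by fun_prop) hij]
          ring
  have hmul : ∀ k, Measurable fun ω => B * C k ω := fun k => (hC k).const_mul B
  calc ∫⁻ x, ‖act B x‖ₑ ^ s ∂(transform μ C ρ)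
      = ∫⁻ ω, ∫⁻ x, ‖∑ i, act (B * C i ω) (x i)‖ₑ ^ s ∂(Measure.pi fun _ : Fin N => ρ) ∂μ := by
        rw [transform, lintegral_map (by fun_prop) (measurable_sum_act hC),
          lintegral_prod _ (by fun_prop)]
        simp only [act_sum, act_mul]
    _ ≤ ∫⁻ ω, (∑ i, ∫⁻ x, ‖act (B * C i ω) x‖ₑ ^ s ∂ρ + c * ∑ i, ∑ j ∈ Finset.univ.erase i,
          ‖B‖ₑ ^ s * G * (‖C i ω‖ₑ ^ (s - 1) * ‖C j ω‖ₑ)) ∂μ := by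
        refine lintegral_mono fun ω => ?_
        refine (lintegral_mono fun x => enorm_sum_rpow_le hs _).trans ?_
        rw [lintegral_add_left (by fun_prop), lintegral_const_mul _ (by fun_prop),
          lintegral_finsetSum _ (by fun_prop), lintegral_finsetSum _ (by fun_prop)]
        gcongr with i _ i _
        · exact (lintegral_pi_eval ρ (f := fun y => ‖act (B * C i ω) y‖ₑ ^ s)
            (by fun_prop) i).le
        · rw [lintegral_finsetSum _ (by fun_prop)]
          exact Finset.sum_le_sum fun j hj => hcross i j (Finset.ne_of_mem_erase hj).symm ω
    _ = _ := by
        have hmi : ∀ i, Measurable fun ω => ∫⁻ x, ‖act (B * C i ω) x‖ₑ ^ s ∂ρ := fun i =>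
          Measurable.lintegral_prod_right' (f := fun p : Ω × EuclideanSpace ℝ (Fin d) =>
            ‖act (B * C i p.1) p.2‖ₑ ^ s) (by
              have : Measurable fun p : Ω × EuclideanSpace ℝ (Fin d) => B * C i p.1 :=
                (hmul i).comp measurable_fst
              exact (measurable_act this measurable_snd).enorm.pow_const s)
        rw [lintegral_add_left (by fun_prop), lintegral_finsetSum _ (fun i _ => hmi i),
          lintegral_const_mul _ (by fun_prop), lintegral_finsetSum _ (by fun_prop)]
        congr 1
        have hrow : ∀ i, ∫⁻ ω, ∑ j ∈ Finset.univ.erase i,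
            ‖B‖ₑ ^ s * G * (‖C i ω‖ₑ ^ (s - 1) * ‖C j ω‖ₑ) ∂μ =
            ‖B‖ₑ ^ s * G * ∑ j ∈ Finset.univ.erase i, L i j := fun i => by
          rw [lintegral_finsetSum _ (by fun_prop), Finset.mul_sum]
          exact Finset.sum_congr rfl fun j _ => lintegral_const_mul _ (by fun_prop)
        simp only [hrow]
        rw [← Finset.mul_sum]
        ring

lemma lintegral_lintegral_enorm_act_le (μ : Measure Ω)
    {A : Ω → Matrix (Fin d) (Fin d) ℝ} (hA : Measurable A) {s : ℝ} (hs : 0 ≤ s)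
    (ρ : Measure (EuclideanSpace ℝ (Fin d))) :
    ∫⁻ ω, ∫⁻ x, ‖act (A ω) x‖ₑ ^ s ∂ρ ∂μ ≤ (∫⁻ ω, ‖A ω‖ₑ ^ s ∂μ) * ∫⁻ x, ‖x‖ₑ ^ s ∂ρ := by
  rw [← lintegral_mul_const _ (by fun_prop)]
  refine lintegral_mono fun ω => ?_
  rw [← lintegral_const_mul _ (by fun_prop)]
  refine lintegral_mono fun x => ?_
  rw [← ENNReal.mul_rpow_of_nonneg _ _ hs]
  exact ENNReal.rpow_le_rpow (enorm_act_le _ _) hs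

lemma lintegral_transform_ne_top (μ : Measure Ω) [IsProbabilityMeasure μ]
    {C : Fin N → Ω → Matrix (Fin d) (Fin d) ℝ} (hC : ∀ i, Measurable (C i)) {s : ℝ} (hs : 1 ≤ s)
    (hCs : ∀ i, ∫⁻ ω, ‖C i ω‖ₑ ^ s ∂μ ≠ ∞) (ρ : Measure (EuclideanSpace ℝ (Fin d)))
    [IsProbabilityMeasure ρ] (h : ∫⁻ x, ‖x‖ₑ ^ s ∂ρ ≠ ∞) :
    ∫⁻ x, ‖x‖ₑ ^ s ∂(transform μ C ρ) ≠ ∞ := by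
  obtain ⟨K, hK, hle⟩ := exists_lintegral_transform_le μ hC hs hCs
  have h1 : ∫⁻ x, ‖x‖ₑ ∂ρ ≠ ∞ := by
    simpa using lintegral_rpow_ne_top_of_le zero_le_one hs h
  have h2 := lintegral_rpow_ne_top_of_le (sub_nonneg.2 hs) (by linarith : s - 1 ≤ s) h
  have := hle ρ 1
  simp only [act_one, one_mul] at this
  refine ne_top_of_le_ne_top (ENNReal.add_ne_top.2 ⟨ENNReal.sum_ne_top.2 fun i _ => ?_, ?_⟩) this
  · exact ne_top_of_le_ne_top (ENNReal.mul_ne_top (hCs i) h)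
      (lintegral_lintegral_enorm_act_le μ (hC i) (by linarith) ρ)
  · have : ‖(1 : Matrix (Fin d) (Fin d) ℝ)‖ₑ ^ s ≠ ∞ :=
      ENNReal.rpow_ne_top_of_nonneg (by linarith) enorm_ne_top
    finiteness

/-- Split at `x = ε⁻¹`. A small multiple of the `s`-th moment then pays for the moment of order `s -
1` in the cross term. -/
lemma rpow_sub_one_le (x : ℝ≥0∞) {ε : ℝ≥0∞} (hε : ε ≠ 0) (hε' : ε ≠ ∞) {s : ℝ} (hs : 1 ≤ s) :
    x ^ (s - 1) ≤ ε * x ^ s + ε⁻¹ ^ (s - 1) := by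
  rcases le_total x ε⁻¹ with h | h
  · exact (ENNReal.rpow_le_rpow h (by linarith)).trans le_add_self
  · refine le_trans ?_ le_self_add
    have h1 : 1 ≤ ε * x := by
      rw [← ENNReal.mul_inv_cancel hε hε']
      gcongr
    conv_rhs => rw [show s = 1 + (s - 1) by ring,
      ENNReal.rpow_add_of_nonneg _ _ zero_le_one (by linarith), ENNReal.rpow_one, ← mul_assoc]
    exact le_mul_of_one_le_left zero_le h1

lemma le_two_mul_of_le_add_half {a x : ℝ≥0∞} (hx : x ≠ ∞) (h : x ≤ a + x / 2) : x ≤ 2 * a := by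
  have h1 : x / 2 + x / 2 ≤ a + x / 2 := by rwa [ENNReal.add_halves]
  have h2 : x / 2 ≤ a := (ENNReal.add_le_add_iff_right (by finiteness)).1 h1
  calc x = x / 2 + x / 2 := (ENNReal.add_halves x).symm
    _ ≤ a + a := add_le_add h2 h2
    _ = 2 * a := (two_mul a).symm

/-- Moments of order `s > 1` of the iterates are bounded if `N^n E ‖Π_n‖^s` is summable and the
first moments are bounded. -/
lemma exists_lintegral_iterate_le (hN : N ≠ 0) (μ : Measure Ω) [IsProbabilityMeasure μ]
    {C : Fin N → Ω → Matrix (Fin d) (Fin d) ℝ} (hC : ∀ i, Measurable (C i)) {s : ℝ} (hs : 1 ≤ s)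
    (hCs : ∀ i, ∫⁻ ω, ‖C i ω‖ₑ ^ s ∂μ ≠ ∞)
    (hsum : ∑' n, scaledMoment N (genericLaw μ C) s n ≠ ∞)
    {ρ : ℕ → Measure (EuclideanSpace ℝ (Fin d))} [∀ n, IsProbabilityMeasure (ρ n)]
    (hρ : ∀ n, ρ (n + 1) = transform μ C (ρ n)) (h0 : ∫⁻ x, ‖x‖ₑ ^ s ∂(ρ 0) ≠ ∞) {A : ℝ≥0∞}
    (hA : A ≠ ∞) (hρA : ∀ n, ∫⁻ x, ‖x‖ₑ ∂(ρ n) ≤ A) :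
    ∃ K : ℝ≥0∞, K ≠ ∞ ∧ ∀ n, ∫⁻ x, ‖x‖ₑ ^ s ∂(ρ n) ≤ K := by
  have hs0 : 0 ≤ s := by linarith
  obtain ⟨K, hK, hle⟩ := exists_lintegral_transform_le μ hC hs hCs
  set S := ∑' n, scaledMoment N (genericLaw μ C) s n with hS
  set M : ℕ → ℝ≥0∞ := fun n => ∫⁻ x, ‖x‖ₑ ^ s ∂(ρ n) with hM
  have hMt : ∀ n, M n ≠ ∞ := by
    intro n
    induction n with
    | zero => exact h0
    | succ n ih =>
      simp only [hM, hρ]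
      exact lintegral_transform_ne_top μ hC hs hCs (ρ n) ih
  -- Chosen so that the `s`-th moments re-entering through the cross terms, summed over all steps,
  -- have total coefficient at most `1/2`; the `+ 1` avoids inverting zero.
  set ε : ℝ≥0∞ := (2 * (K * A * S + 1))⁻¹ with hε
  have hε0 : ε ≠ 0 := by simp only [hε, ne_eq, ENNReal.inv_eq_zero]; finiteness
  have hεt : ε ≠ ∞ := by simp [hε]
  have hεhalf : K * A * S * ε ≤ 2⁻¹ := by
    rw [hε, ENNReal.mul_inv (by simp) (by simp), mul_left_comm]
    refine mul_le_of_le_one_right zero_le ?_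
    exact (mul_le_mul_left le_self_add _).trans
      (ENNReal.mul_inv_cancel (a := K * A * S + 1) (by simp) (by finiteness)).le
  set D := ε⁻¹ ^ (s - 1) with hD
  have hDt : D ≠ ∞ := ENNReal.rpow_ne_top_of_nonneg (by linarith) (ENNReal.inv_ne_top.2 hε0)
  set a := M 0 * S + K * A * S * D with ha
  refine ⟨2 * a, ?_, fun n => ?_⟩
  · have := hMt 0
    finiteness
  -- The maximum over finitely many steps is finite, so half of it may be subtracted; the resulting
  -- bound `2 * a` no longer depends on `n`.
  set Mx := (Finset.range (n + 1)).sup M with hMx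
  have hMxt : Mx ≠ ∞ := by
    refine ((Finset.sup_lt_iff ENNReal.zero_lt_top).2 fun k _ => (hMt k).lt_top).ne
  have hkey : ∀ k ≤ n, M k ≤ a + Mx / 2 := by
    intro k hk
    have hrec := le_weight_of_recursion hN μ hC (s := s) (c := M 0)
      (f := fun n B => ∫⁻ x, ‖act B x‖ₑ ^ s ∂(ρ n)) (g := fun n => K * ((ε * M n + D) * A))
      (fun B => by
        simp only [hM]
        rw [mul_comm, ← lintegral_const_mul _ (by fun_prop)]
        refine lintegral_mono fun x => ?_
        rw [← ENNReal.mul_rpow_of_nonneg _ _ hs0]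
        exact ENNReal.rpow_le_rpow (enorm_act_le _ _) hs0)
      (fun n B => by
        rw [hρ n]
        refine (hle (ρ n) B).trans ?_
        gcongr
        · simp only [hM]
          rw [← lintegral_const_mul _ (by fun_prop)]
          refine (lintegral_mono fun x => rpow_sub_one_le ‖x‖ₑ hε0 hεt hs).trans ?_
          rw [lintegral_add_left (by fun_prop)]
          simp [hD]
        · exact hρA n) k 1
    simp only [act_one, weight_one] at hrec
    refine hrec.trans ?_
    calc _ ≤ M 0 * S + ∑ j ∈ Finset.range k, K * ((ε * Mx + D) * A) *
            scaledMoment N (genericLaw μ C) s j := by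
          gcongr with j hj
          · exact ENNReal.le_tsum k
          · have := Finset.mem_range.1 hj
            exact Finset.le_sup (f := M) (Finset.mem_range.2 (by omega))
      _ ≤ M 0 * S + K * ((ε * Mx + D) * A) * S := by
          rw [← Finset.mul_sum]
          gcongr
          exact ENNReal.sum_le_tsum _
      _ = a + (K * A * S * ε) * Mx := by rw [ha]; ring
      _ ≤ a + Mx / 2 := by
          rw [ENNReal.div_eq_inv_mul]
          gcongr
  exact (Finset.le_sup (f := M) (Finset.self_mem_range_succ n)).trans
    (le_two_mul_of_le_add_half hMxt
      (Finset.sup_le fun k hk => hkey k (Nat.lt_succ_iff.1 (Finset.mem_range.1 hk))))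

/-! ### First moments from characteristic functions. -/

/-- At the dyadic scale with `1 ≤ |x| / 2 ^ k < 2` one has `1 - cos ≥ 4/9`, and `5 * 4/9 ≥ 2`. -/
lemma abs_le_of_one_le_abs {x : ℝ} (hx : 1 ≤ |x|) :
    ∃ k : ℕ, |x| ≤ 5 * 2 ^ k * (1 - Real.cos (x / 2 ^ k)) := by
  obtain ⟨k, hk1, hk2⟩ := exists_nat_pow_near hx one_lt_two
  refine ⟨k, ?_⟩
  have h2 : (0 : ℝ) < 2 ^ k := by positivity
  have hy1 : 1 ≤ |x| / 2 ^ k := (one_le_div h2).2 hk1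
  have hy2 : |x| / 2 ^ k ≤ 2 := by
    rw [div_le_iff₀ h2]
    rw [pow_succ] at hk2
    linarith
  have hcos : Real.cos (x / 2 ^ k) ≤ 5 / 9 := by
    rw [← Real.cos_abs, abs_div, abs_of_pos h2]
    exact (Real.cos_le_cos_of_nonneg_of_le_pi zero_le_one
      (hy2.trans (by linarith [Real.pi_gt_three])) hy1).trans Real.cos_one_le
  rw [pow_succ] at hk2
  nlinarith

/-- Summing over all scales removes the dependence of `k` on `x`, so that the bound can be
integrated termwise. -/
lemma enorm_le_one_add_tsum (x : ℝ) :
    ‖x‖ₑ ≤ 1 + ∑' k : ℕ, ENNReal.ofReal (5 * 2 ^ k) * ENNReal.ofReal (1 - Real.cos (x / 2 ^ k)) := by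
  rw [← ofReal_norm, Real.norm_eq_abs]
  rcases le_total |x| 1 with h | h
  · exact (ENNReal.ofReal_le_one.2 h).trans le_self_add
  · obtain ⟨k, hk⟩ := abs_le_of_one_le_abs h
    refine (ENNReal.ofReal_le_ofReal hk).trans (le_trans ?_ le_add_self)
    rw [ENNReal.ofReal_mul (by positivity)]
    exact ENNReal.le_tsum k

lemma lintegral_one_sub_cos_inner (ρ : Measure (EuclideanSpace ℝ (Fin d))) [IsProbabilityMeasure ρ]
    (u : EuclideanSpace ℝ (Fin d)) :
    ∫⁻ x, ENNReal.ofReal (1 - Real.cos (inner ℝ x u)) ∂ρ =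
      ENNReal.ofReal (1 - (charFun ρ u).re) := by
  have hc : Integrable (fun x : EuclideanSpace ℝ (Fin d) => Real.cos (inner ℝ x u)) ρ :=
    Integrable.of_bound (C := 1) (Measurable.aestronglyMeasurable (by fun_prop))
      (.of_forall fun x => by simpa using Real.abs_cos_le_one _)
  have hexp : Integrable (fun x : EuclideanSpace ℝ (Fin d) =>
      Complex.exp ((inner ℝ x u : ℝ) * Complex.I)) ρ :=
    Integrable.of_bound (C := 1) (Measurable.aestronglyMeasurable (by fun_prop))
      (.of_forall fun x => by rw [Complex.norm_exp_ofReal_mul_I])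
  have hre : (charFun ρ u).re = ∫ x, Real.cos (inner ℝ x u) ∂ρ := by
    rw [charFun_apply, ← RCLike.re_eq_complex_re, ← integral_re hexp]
    simp [Complex.exp_ofReal_mul_I_re]
  rw [← ofReal_integral_eq_lintegral_ofReal (f := fun x => 1 - Real.cos (inner ℝ x u))
    ((integrable_const 1).sub hc) (.of_forall fun x => sub_nonneg.2 (Real.cos_le_one _)), integral_sub (integrable_const 1) hc,
    hre]
  simp

/-- The first moment is controlled by the real part of the characteristic function near `0`. -/
lemma exists_lintegral_enorm_le (d : ℕ) (c : ℝ) {q : ℝ} (hq : 1 < q) :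
    ∃ K : ℝ≥0∞, K ≠ ∞ ∧ ∀ (ρ : Measure (EuclideanSpace ℝ (Fin d))) [IsProbabilityMeasure ρ],
      (∀ u, ‖u‖ ≤ 1 → 1 - (charFun ρ u).re ≤ c * ‖u‖ ^ q) → ∫⁻ x, ‖x‖ₑ ∂ρ ≤ K := by
  -- Scale `k` contributes `2 ^ k` times `(2 ^ (-k)) ^ q`, a geometric series with ratio below `1`
  -- exactly because `q > 1`.
  set θ : ℝ := 2 ^ (1 - q) with hθ
  have hθ0 : 0 < θ := by positivity
  have hθ1 : θ < 1 := Real.rpow_lt_one_of_one_lt_of_neg one_lt_two (by linarith)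
  refine ⟨d * (1 + ∑' k : ℕ, ENNReal.ofReal (5 * c) * ENNReal.ofReal θ ^ k), ?_, fun ρ _ h => ?_⟩
  · rw [ENNReal.tsum_mul_left, ENNReal.tsum_geometric]
    have : (1 - ENNReal.ofReal θ)⁻¹ ≠ ∞ := by
      rw [ENNReal.inv_ne_top, ne_eq, tsub_eq_zero_iff_le, not_le]
      exact ENNReal.ofReal_lt_one.2 hθ1
    finiteness
  have hcoord : ∀ i : Fin d, ∫⁻ x, ‖x i‖ₑ ∂ρ ≤
      1 + ∑' k : ℕ, ENNReal.ofReal (5 * c) * ENNReal.ofReal θ ^ k := by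
    intro i
    have hcosm : ∀ k : ℕ, Measurable fun x : EuclideanSpace ℝ (Fin d) =>
        ENNReal.ofReal (1 - Real.cos (x i / 2 ^ k)) := fun k =>
      (measurable_const.sub (Real.measurable_cos.comp
        (Measurable.div_const (by fun_prop) _))).ennreal_ofReal
    have hterm : ∀ k : ℕ, Measurable fun x : EuclideanSpace ℝ (Fin d) =>
        ENNReal.ofReal (5 * 2 ^ k) * ENNReal.ofReal (1 - Real.cos (x i / 2 ^ k)) :=
      fun k => (hcosm k).const_mul _
    have hsplit : ∫⁻ x : EuclideanSpace ℝ (Fin d), (1 + ∑' k : ℕ, ENNReal.ofReal (5 * 2 ^ k) *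
        ENNReal.ofReal (1 - Real.cos (x i / 2 ^ k))) ∂ρ = 1 + ∑' k : ℕ, ∫⁻ x,
        ENNReal.ofReal (5 * 2 ^ k) * ENNReal.ofReal (1 - Real.cos (x i / 2 ^ k)) ∂ρ := by
      rw [lintegral_add_left measurable_const, lintegral_tsum fun k => (hterm k).aemeasurable,
        lintegral_const, measure_univ, mul_one]
    have hle : ∫⁻ x, ‖x i‖ₑ ∂ρ ≤ ∫⁻ x : EuclideanSpace ℝ (Fin d), (1 + ∑' k : ℕ,
        ENNReal.ofReal (5 * 2 ^ k) * ENNReal.ofReal (1 - Real.cos (x i / 2 ^ k))) ∂ρ :=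
      lintegral_mono fun x => enorm_le_one_add_tsum (x i)
    refine hle.trans (hsplit.le.trans ?_)
    gcongr with k
    rw [lintegral_const_mul _ (hcosm k)]
    set u : EuclideanSpace ℝ (Fin d) := EuclideanSpace.single i ((2 ^ k)⁻¹ : ℝ) with hu
    have hux : ∀ x : EuclideanSpace ℝ (Fin d), inner ℝ x u = x i / 2 ^ k := fun x => by
      simp [hu, EuclideanSpace.inner_single_right, div_eq_inv_mul]
    have hun : ‖u‖ = (2 ^ k)⁻¹ := by simp [hu]
    have hcos := lintegral_one_sub_cos_inner ρ u
    simp only [hux] at hcos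
    rw [hcos, ← ENNReal.ofReal_mul (by positivity), ← ENNReal.ofReal_pow hθ0.le]
    rw [← ENNReal.ofReal_mul' (by positivity)]
    apply ENNReal.ofReal_le_ofReal
    have hbd := h u (by rw [hun]; exact inv_le_one_of_one_le₀ (one_le_pow₀ one_le_two))
    have hpow : ‖u‖ ^ q * 2 ^ k = θ ^ k := by
      rw [hun, hθ, ← Real.rpow_natCast, ← Real.rpow_natCast, ← Real.rpow_neg two_pos.le,
        ← Real.rpow_mul two_pos.le, ← Real.rpow_mul two_pos.le, ← Real.rpow_add two_pos]
      ring_nf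
    calc 5 * 2 ^ k * (1 - (charFun ρ u).re) ≤ 5 * 2 ^ k * (c * ‖u‖ ^ q) := by gcongr
      _ = 5 * c * (‖u‖ ^ q * 2 ^ k) := by ring
      _ = _ := by rw [hpow]
  calc ∫⁻ x, ‖x‖ₑ ∂ρ ≤ ∫⁻ x, ∑ i, ‖x i‖ₑ ∂ρ := by
        refine lintegral_mono fun x => ?_
        have hx : ‖x‖ₑ = ‖∑ i, EuclideanSpace.single i (x i)‖ₑ := by
          congr 1
          ext k
          simp [Finset.sum_apply, Pi.single_apply]
        rw [hx]
        refine (enorm_sum_le _ _).trans (le_of_eq ?_)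
        refine Finset.sum_congr rfl fun i _ => ?_
        rw [← ofReal_norm, ← ofReal_norm, PiLp.norm_single]
    _ = ∑ i, ∫⁻ x, ‖x i‖ₑ ∂ρ := lintegral_finsetSum _ (by fun_prop)
    _ ≤ ∑ _i : Fin d, (1 + ∑' k : ℕ, ENNReal.ofReal (5 * c) * ENNReal.ofReal θ ^ k) :=
        Finset.sum_le_sum fun i _ => hcoord i
    _ = _ := by rw [Finset.sum_const, Finset.card_univ, Fintype.card_fin, nsmul_eq_mul]

/-! ### Weak limits and existence of fixed points. -/

/-- Lower semicontinuity of moments under weak convergence, by the portmanteau theorem on open sets.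
-/
lemma lintegral_enorm_rpow_le_of_tendsto {P : ℕ → ProbabilityMeasure (EuclideanSpace ℝ (Fin d))}
    {Q : ProbabilityMeasure (EuclideanSpace ℝ (Fin d))} (h : Tendsto P atTop (𝓝 Q)) {s : ℝ}
    (hs : 0 ≤ s) {K : ℝ≥0∞}
    (hK : ∀ n, ∫⁻ x, ‖x‖ₑ ^ s ∂(P n : Measure (EuclideanSpace ℝ (Fin d))) ≤ K) :
    ∫⁻ x, ‖x‖ₑ ^ s ∂(Q : Measure (EuclideanSpace ℝ (Fin d))) ≤ K := by
  have h1 := lintegral_le_liminf_lintegral_of_forall_isOpen_measure_le_liminf_measure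
    (μ := (Q : Measure (EuclideanSpace ℝ (Fin d))))
    (μs := fun n => (P n : Measure (EuclideanSpace ℝ (Fin d)))) (f := fun x => ‖x‖ ^ s)
    (continuous_norm.rpow_const fun _ => .inr hs) (fun x => Real.rpow_nonneg (norm_nonneg x) s)
    (fun G hG => ProbabilityMeasure.le_liminf_measure_open_of_tendsto h hG)
  simp only [← ENNReal.ofReal_rpow_of_nonneg (norm_nonneg _) hs, ofReal_norm] at h1
  refine h1.trans ?_
  calc _ ≤ liminf (fun _ : ℕ => K) atTop := liminf_le_liminf (.of_forall hK)
    _ = K := liminf_const K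

/-- The first-order Taylor polynomial of `charFun ρ₀` has real part `1`, its linear term being
imaginary. What remains is its quadratic remainder plus the Fourier distance, and for `‖u‖ ≤ 1` the
smaller exponent dominates. -/
lemma one_sub_re_charFun_le (ρ ρ₀ : Measure (EuclideanSpace ℝ (Fin d))) [IsProbabilityMeasure ρ]
    [IsProbabilityMeasure ρ₀] (h₀ : ∫⁻ x, ‖x‖ₑ ^ (2 : ℝ) ∂ρ₀ ≠ ∞) {c : ℝ≥0∞} (hc : c ≠ ∞) {p : ℝ}
    (hp : 0 ≤ p) (h : ∀ u, ‖charFun ρ₀ u - charFun ρ u‖ₑ ≤ c * ‖u‖ₑ ^ p)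
    {u : EuclideanSpace ℝ (Fin d)} (hu : ‖u‖ ≤ 1) :
    1 - (charFun ρ u).re ≤
      (4 * (∫⁻ x, ‖x‖ₑ ^ (2 : ℝ) ∂ρ₀) + c).toReal * ‖u‖ ^ min p 2 := by
  set q := min p 2 with hq
  have hq0 : 0 ≤ q := le_min hp zero_le_two
  set M := ∫⁻ x, ‖x‖ₑ ^ (2 : ℝ) ∂ρ₀ with hM
  have hue : ‖u‖ₑ ≤ 1 := by
    rw [← ofReal_norm]
    exact ENNReal.ofReal_le_one.2 hu
  have h1 := enorm_charFun_sub_taylor_le ρ₀ (j := 2) two_ne_zero (by norm_num) (p := 2)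
    (by norm_num) (by norm_num) h₀ u
  set T : ℂ := ∑ m ∈ Finset.range 2,
      ((∫ x, inner ℝ x u ^ m ∂ρ₀ : ℝ) : ℂ) * (Complex.I ^ m / m.factorial) with hT
  have hTre : T.re = 1 := by simp [hT, Finset.sum_range_succ]
  have key : ‖T - charFun ρ u‖ₑ ≤ (4 * M + c) * ‖u‖ₑ ^ q := by
    rw [show T - charFun ρ u = -(charFun ρ₀ u - T) + (charFun ρ₀ u - charFun ρ u) by ring]
    refine (enorm_add_le _ _).trans ?_
    rw [enorm_neg, add_mul]
    refine add_le_add (h1.trans ?_) ((h u).trans ?_)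
    · exact mul_le_mul_right (ENNReal.rpow_le_rpow_of_exponent_ge hue (min_le_right _ _)) _
    · exact mul_le_mul_right (ENNReal.rpow_le_rpow_of_exponent_ge hue (min_le_left _ _)) _
  calc 1 - (charFun ρ u).re = (T - charFun ρ u).re := by rw [Complex.sub_re, hTre]
    _ ≤ ‖T - charFun ρ u‖ := Complex.re_le_norm _
    _ = ‖T - charFun ρ u‖ₑ.toReal := (toReal_enorm _).symm
    _ ≤ ((4 * M + c) * ‖u‖ₑ ^ q).toReal := ENNReal.toReal_mono (by finiteness) key
    _ = _ := by rw [ENNReal.toReal_mul, ← ENNReal.toReal_rpow, toReal_enorm]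

/-- Lévy's continuity theorem: continuity at `0` gives tightness, and a limit point along an
ultrafilter must have characteristic function `f`. -/
lemma exists_charFun_eq_of_tendsto (P : ℕ → ProbabilityMeasure (EuclideanSpace ℝ (Fin d)))
    {f : EuclideanSpace ℝ (Fin d) → ℂ} (hf : ContinuousAt f 0)
    (h : ∀ u, Tendsto (fun n => charFun (P n : Measure (EuclideanSpace ℝ (Fin d))) u) atTop
      (𝓝 (f u))) :
    ∃ Q : ProbabilityMeasure (EuclideanSpace ℝ (Fin d)),
      charFun (Q : Measure (EuclideanSpace ℝ (Fin d))) = f ∧ Tendsto P atTop (𝓝 Q) := by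
  have htight := isTightMeasureSet_of_tendsto_charFun hf h
  have hcomp : IsCompact (closure (Set.range P)) := by
    apply isCompact_closure_of_isTightMeasureSet
    have himage : {(ν : Measure (EuclideanSpace ℝ (Fin d))) | ν ∈ Set.range P} =
        Set.range fun n => (P n : Measure (EuclideanSpace ℝ (Fin d))) :=
      (Set.range_comp _ P).symm
    rw [himage]
    exact htight
  obtain ⟨Q, -, hQ⟩ := hcomp.ultrafilter_le_nhds ((Filter.hyperfilter ℕ).map P) (by
    rw [le_principal_iff]
    exact Filter.mem_map.2 (univ_mem' fun n => subset_closure (mem_range_self n)))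
  have hQ' : Tendsto P (Filter.hyperfilter ℕ) (𝓝 Q) := hQ
  have hchar : charFun (Q : Measure (EuclideanSpace ℝ (Fin d))) = f := by
    funext u
    rw [ProbabilityMeasure.tendsto_iff_forall_integral_rclike_tendsto ℂ] at hQ'
    have h1 := hQ' (BoundedContinuousFunction.innerProbChar u)
    simp_rw [← charFun_eq_integral_innerProbChar] at h1
    exact tendsto_nhds_unique h1 ((h u).mono_left Nat.hyperfilter_le_atTop)
  refine ⟨Q, hchar, ProbabilityMeasure.tendsto_iff_tendsto_charFun.2 fun u => ?_⟩
  rw [hchar]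
  exact h u

lemma tendsto_charFun_transform (μ : Measure Ω) [IsProbabilityMeasure μ]
    {C : Fin N → Ω → Matrix (Fin d) (Fin d) ℝ} (hC : ∀ i, Measurable (C i))
    {ρ : ℕ → Measure (EuclideanSpace ℝ (Fin d))} [∀ n, IsProbabilityMeasure (ρ n)]
    {ρ' : Measure (EuclideanSpace ℝ (Fin d))} [IsProbabilityMeasure ρ']
    (h : ∀ u, Tendsto (fun n => charFun (ρ n) u) atTop (𝓝 (charFun ρ' u)))
    (u : EuclideanSpace ℝ (Fin d)) :
    Tendsto (fun n => charFun (transform μ C (ρ n)) u) atTop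
      (𝓝 (charFun (transform μ C ρ') u)) := by
  simp only [charFun_transform μ hC]
  refine tendsto_integral_of_dominated_convergence (fun _ => 1)
    (fun n => (Finset.measurable_prod _ fun i _ =>
      measurable_charFun_act (ρ n) (hC i) u).aestronglyMeasurable) (integrable_const 1)
    (fun n => .of_forall fun ω => (Finset.norm_prod_le _ _).trans
      (Finset.prod_le_one (fun _ _ => norm_nonneg _) fun j _ => norm_charFun_le_one _))
    (.of_forall fun ω => tendsto_finsetProd _ fun i _ => h _)

/-- Existence of a fixed point as the limit of the iterates of a law whose moments of order less
than `j` are preserved by the smoothing transform. -/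
theorem exists_fixed_of_momentsMatch (hN : N ≠ 0) (μ : Measure Ω) [IsProbabilityMeasure μ]
    {C : Fin N → Ω → Matrix (Fin d) (Fin d) ℝ} (hC : ∀ i, Measurable (C i)) {j : ℕ} (hj : 2 ≤ j)
    (hj3 : j ≤ 3) {p : ℝ} (hp : (j : ℝ) - 1 < p) (hpj : p ≤ j)
    (hCp : ∀ i, ∫⁻ ω, ‖C i ω‖ₑ ^ p ∂μ ≠ ∞)
    (hsum : ∑' n, scaledMoment N (genericLaw μ C) p n ≠ ∞)
    (ρ₀ : Measure (EuclideanSpace ℝ (Fin d))) [IsProbabilityMeasure ρ₀]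
    (h₀ : ∀ s : ℝ, 0 ≤ s → ∫⁻ x, ‖x‖ₑ ^ s ∂ρ₀ ≠ ∞)
    (hm : MomentsMatch j ρ₀ (transform μ C ρ₀)) :
    ∃ ρ : Measure (EuclideanSpace ℝ (Fin d)), IsProbabilityMeasure ρ ∧ transform μ C ρ = ρ ∧
      (∃ c : ℝ≥0∞, c ≠ ∞ ∧ ∀ u, ‖charFun ρ₀ u - charFun ρ u‖ₑ ≤ c * ‖u‖ₑ ^ p) ∧
      ∀ s : ℝ, 1 ≤ s → (∀ i, ∫⁻ ω, ‖C i ω‖ₑ ^ s ∂μ ≠ ∞) →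
        ∑' n, scaledMoment N (genericLaw μ C) s n ≠ ∞ → ∫⁻ x, ‖x‖ₑ ^ s ∂ρ ≠ ∞ := by
  have hp1 : 1 < p := by
    have : (2 : ℝ) ≤ j := by exact_mod_cast hj
    linarith
  have hp0 : 0 < p := by linarith
  set ρ : ℕ → Measure (EuclideanSpace ℝ (Fin d)) := fun n => (transform μ C)^[n] ρ₀ with hρ
  have hsucc : ∀ n, ρ (n + 1) = transform μ C (ρ n) := fun n =>
    Function.iterate_succ_apply' _ n ρ₀
  have hprob : ∀ n, IsProbabilityMeasure (ρ n) := by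
    intro n
    induction n with
    | zero => simpa [hρ]
    | succ n ih =>
      rw [hsucc]
      exact isProbabilityMeasure_transform μ hC _
  set c := 4 * (∫⁻ x, ‖x‖ₑ ^ p ∂ρ₀ + ∫⁻ x, ‖x‖ₑ ^ p ∂(ρ 1)) with hc
  have h1 : ∫⁻ x, ‖x‖ₑ ^ p ∂(ρ 1) ≠ ∞ :=
    lintegral_transform_ne_top μ hC hp1.le hCp ρ₀ (h₀ p hp0.le)
  have hct : c ≠ ∞ := by
    have := h₀ p hp0.le
    finiteness
  set S := ∑' n, scaledMoment N (genericLaw μ C) p n with hS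
  have hstep : ∀ u n, edist (charFun (ρ n) u) (charFun (ρ (n + 1)) u) ≤
      c * ‖u‖ₑ ^ p * scaledMoment N (genericLaw μ C) p n := by
    intro u n
    rw [edist_eq_enorm_sub]
    exact enorm_charFun_iterate_sub_le hN μ hC hp0.le (ρ := ρ) (ρ' := fun n => ρ (n + 1)) hsucc
      (fun n => hsucc (n + 1)) (enorm_charFun_sub_le (by omega) hj3 hp.le hpj (h₀ p hp0.le) h1 hm)
      n u
  have hsumu : ∀ u : EuclideanSpace ℝ (Fin d),
      ∑' n, c * ‖u‖ₑ ^ p * scaledMoment N (genericLaw μ C) p n ≠ ∞ := fun u => by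
    rw [ENNReal.tsum_mul_left]
    finiteness
  choose f hf using fun u => cauchySeq_tendsto_of_complete
    (cauchySeq_of_edist_le_of_tsum_ne_top _ (hstep u) (hsumu u))
  have hdist : ∀ n u, ‖charFun ρ₀ u - charFun (ρ n) u‖ₑ ≤ c * S * ‖u‖ₑ ^ p := by
    intro n u
    rw [← edist_eq_enorm_sub]
    refine (edist_le_range_sum_of_edist_le (f := fun n => charFun (ρ n) u) n
      fun {k} _ => hstep u k).trans ((ENNReal.sum_le_tsum _).trans (le_of_eq ?_))
    rw [ENNReal.tsum_mul_left, hS]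
    ring
  have hdistf : ∀ u, ‖charFun ρ₀ u - f u‖ₑ ≤ c * S * ‖u‖ₑ ^ p := fun u =>
    le_of_tendsto ((tendsto_const_nhds.sub (hf u)).enorm) (.of_forall fun n => hdist n u)
  -- The limit inherits the uniform estimate at order `p > 0`, so it is continuous at `0` like
  -- `charFun ρ₀`.
  have hcont : ContinuousAt f 0 := by
    have hlim : Tendsto (fun u : EuclideanSpace ℝ (Fin d) => c * S * ‖u‖ₑ ^ p) (𝓝 0) (𝓝 0) := by
      have : Tendsto (fun u : EuclideanSpace ℝ (Fin d) => c * S * ‖u‖ₑ ^ p) (𝓝 0)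
          (𝓝 (c * S * ‖(0 : EuclideanSpace ℝ (Fin d))‖ₑ ^ p)) :=
        ENNReal.Tendsto.const_mul
          ((ENNReal.continuous_rpow_const.comp continuous_enorm).tendsto _)
          (.inr (by finiteness))
      simpa [hp0] using this
    have hd : Tendsto (fun u => charFun ρ₀ u - f u) (𝓝 0) (𝓝 0) :=
      tendsto_zero_iff_enorm_tendsto_zero.2
        (tendsto_of_tendsto_of_tendsto_of_le_of_le tendsto_const_nhds hlim (fun _ => zero_le)
          hdistf)
    have hf0 : f 0 = charFun ρ₀ 0 := by
      have := hdistf 0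
      rw [enorm_zero, ENNReal.zero_rpow_of_pos hp0, mul_zero, nonpos_iff_eq_zero, enorm_eq_zero,
        sub_eq_zero] at this
      exact this.symm
    have hφ : Tendsto (charFun ρ₀) (𝓝 0) (𝓝 (charFun ρ₀ 0)) :=
      (by fun_prop : Continuous (charFun ρ₀)).tendsto 0
    have := hφ.sub hd
    simpa [ContinuousAt, hf0] using this
  obtain ⟨Q, hQf, hQ⟩ := exists_charFun_eq_of_tendsto (fun n => ⟨ρ n, hprob n⟩) hcont hf
  subst hQf
  refine ⟨Q, inferInstance, ?_, ⟨c * S, by finiteness, hdistf⟩, fun s hs hCs hss => ?_⟩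
  · have := isProbabilityMeasure_transform μ hC (Q : Measure (EuclideanSpace ℝ (Fin d)))
    refine Measure.ext_of_charFun (funext fun u => ?_)
    have hl := tendsto_charFun_transform μ hC hf u
    simp only [← hsucc] at hl
    exact tendsto_nhds_unique hl ((tendsto_add_atTop_iff_nat 1).2 (hf u))
  -- All iterates stay within Fourier distance `c * S` of `ρ₀`, and `min p 2 > 1`; hence their first
  -- moments are uniformly bounded, as the recursion for order `s` requires.
  · obtain ⟨A, hA, hbound⟩ := exists_lintegral_enorm_le d
      (4 * (∫⁻ x, ‖x‖ₑ ^ (2 : ℝ) ∂ρ₀) + c * S).toReal (q := min p 2) (lt_min hp1 one_lt_two)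
    obtain ⟨K, hK, hle⟩ := exists_lintegral_iterate_le hN μ hC hs hCs hss hsucc
      (h₀ s (by linarith)) hA fun n => hbound (ρ n) fun u hu =>
        one_sub_re_charFun_le (ρ n) ρ₀ (h₀ 2 zero_le_two) (by finiteness) hp0.le (hdist n) hu
    exact ne_top_of_le_ne_top hK (lintegral_enorm_rpow_le_of_tendsto hQ (by linarith) hle)

/-! ### Mean and covariance under the transform. -/

lemma integral_inner_eq {ρ : Measure (EuclideanSpace ℝ (Fin d))} (h : Integrable id ρ)
    (u : EuclideanSpace ℝ (Fin d)) : ∫ x, inner ℝ x u ∂ρ = inner ℝ (∫ x, x ∂ρ) u := by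
  rw [real_inner_comm, ← integral_inner (f := fun x => x) h]
  simp only [real_inner_comm]

lemma momentsMatch_one (ρ ρ' : Measure (EuclideanSpace ℝ (Fin d))) [IsProbabilityMeasure ρ]
    [IsProbabilityMeasure ρ'] : MomentsMatch 1 ρ ρ' := by
  intro m hm u
  interval_cases m
  simp

lemma momentsMatch_two {ρ ρ' : Measure (EuclideanSpace ℝ (Fin d))} [IsProbabilityMeasure ρ]
    [IsProbabilityMeasure ρ'] (h : ∀ u, ∫ x, inner ℝ x u ∂ρ = ∫ x, inner ℝ x u ∂ρ') :
    MomentsMatch 2 ρ ρ' := by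
  intro m hm u
  interval_cases m
  · simp
  · simpa using h u

lemma mean_eq_of_momentsMatch {ρ ρ' : Measure (EuclideanSpace ℝ (Fin d))} (hρ : Integrable id ρ)
    (hρ' : Integrable id ρ') (h : MomentsMatch 2 ρ ρ') : ∫ x, x ∂ρ = ∫ x, x ∂ρ' := by
  refine ext_inner_right ℝ fun u => ?_
  rw [← integral_inner_eq hρ, ← integral_inner_eq hρ']
  simpa using h 1 one_lt_two u

lemma integrable_id_of_lintegral_rpow {ρ : Measure (EuclideanSpace ℝ (Fin d))}
    [IsProbabilityMeasure ρ] {p : ℝ} (hp : 1 ≤ p) (h : ∫⁻ x, ‖x‖ₑ ^ p ∂ρ ≠ ∞) :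
    Integrable id ρ := by
  refine ⟨aestronglyMeasurable_id, ?_⟩
  have := lintegral_rpow_ne_top_of_le zero_le_one hp h
  simp only [ENNReal.rpow_one] at this
  exact this.lt_top

lemma memLp_inner {ρ : Measure (EuclideanSpace ℝ (Fin d))} [IsProbabilityMeasure ρ] {p : ℝ}
    (hp : 2 ≤ p) (h : ∫⁻ x, ‖x‖ₑ ^ p ∂ρ ≠ ∞) (u : EuclideanSpace ℝ (Fin d)) :
    MemLp (fun x => inner ℝ x u) 2 ρ :=
  (memLp_two_iff_integrable_sq (Measurable.aestronglyMeasurable (by fun_prop))).2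
    (integrable_inner_pow ρ h (m := 2) (by exact_mod_cast hp) u)

lemma inner_single (x : EuclideanSpace ℝ (Fin d)) (a : Fin d) :
    inner ℝ x (EuclideanSpace.single a (1 : ℝ)) = x a := by
  simp [EuclideanSpace.inner_single_right]

lemma memLp_coord {ρ : Measure (EuclideanSpace ℝ (Fin d))} [IsProbabilityMeasure ρ] {p : ℝ}
    (hp : 2 ≤ p) (h : ∫⁻ x, ‖x‖ₑ ^ p ∂ρ ≠ ∞) (a : Fin d) :
    MemLp (fun x : EuclideanSpace ℝ (Fin d) => x a) 2 ρ := by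
  simpa only [inner_single] using memLp_inner hp h (EuclideanSpace.single a 1)

lemma variance_inner (μ : Measure Ω) [IsProbabilityMeasure μ]
    {X : Ω → EuclideanSpace ℝ (Fin d)} (hX : ∀ a, MemLp (fun ω => X ω a) 2 μ)
    (u : EuclideanSpace ℝ (Fin d)) :
    Var[fun ω => inner ℝ (X ω) u; μ] = ∑ a, ∑ b, u a * u b * covMatrix μ X a b := by
  have h1 : (fun ω => inner ℝ (X ω) u) = fun ω => ∑ a, u a * X ω a := by
    funext ω
    simp [PiLp.inner_apply]
  rw [h1, variance_fun_sum fun a => (hX a).const_mul (u a)]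
  refine Finset.sum_congr rfl fun a _ => Finset.sum_congr rfl fun b _ => ?_
  rw [covariance_const_mul_left, covariance_const_mul_right, covMatrix, Matrix.of_apply, mul_assoc]

lemma integral_inner_sq_eq {ρ : Measure (EuclideanSpace ℝ (Fin d))} [IsProbabilityMeasure ρ]
    {p : ℝ} (hp : 2 ≤ p) (h : ∫⁻ x, ‖x‖ₑ ^ p ∂ρ ≠ ∞) (u : EuclideanSpace ℝ (Fin d)) :
    ∫ x, inner ℝ x u ^ 2 ∂ρ =
      ∑ a, ∑ b, u a * u b * covMatrix ρ id a b + (∫ x, inner ℝ x u ∂ρ) ^ 2 := by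
  have h1 := variance_eq_sub (memLp_inner hp h u)
  rw [variance_inner ρ (X := fun x => x) (memLp_coord hp h)] at h1
  simp only [Pi.pow_apply] at h1
  change _ = ∑ a, ∑ b, u a * u b * covMatrix ρ (fun x => x) a b + _
  rw [h1]
  ring

lemma momentsMatch_three {ρ ρ' : Measure (EuclideanSpace ℝ (Fin d))} [IsProbabilityMeasure ρ]
    [IsProbabilityMeasure ρ'] (h : ∀ u, ∫ x, inner ℝ x u ∂ρ = ∫ x, inner ℝ x u ∂ρ')
    (h2 : ∀ u, ∫ x, inner ℝ x u ^ 2 ∂ρ = ∫ x, inner ℝ x u ^ 2 ∂ρ') :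
    MomentsMatch 3 ρ ρ' := by
  intro m hm u
  interval_cases m
  · simp
  · simpa using h u
  · exact h2 u

/-- Polarization: covariances are recovered from the variances in all directions. -/
lemma covMatrix_eq_of_momentsMatch {ρ ρ' : Measure (EuclideanSpace ℝ (Fin d))}
    [IsProbabilityMeasure ρ] [IsProbabilityMeasure ρ'] {p : ℝ} (hp : 2 ≤ p)
    (hρ : ∫⁻ x, ‖x‖ₑ ^ p ∂ρ ≠ ∞) (hρ' : ∫⁻ x, ‖x‖ₑ ^ p ∂ρ' ≠ ∞) (h : MomentsMatch 3 ρ ρ') :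
    covMatrix ρ id = covMatrix ρ' id := by
  have hvar : ∀ u : EuclideanSpace ℝ (Fin d),
      Var[fun x => inner ℝ x u; ρ] = Var[fun x => inner ℝ x u; ρ'] := fun u => by
    rw [variance_eq_sub (memLp_inner hp hρ u), variance_eq_sub (memLp_inner hp hρ' u)]
    have h1 := h 1 (by norm_num) u
    have h2 := h 2 (by norm_num) u
    simp only [pow_one] at h1
    simp only [Pi.pow_apply, h1, h2]
  have hcov : ∀ (κ : Measure (EuclideanSpace ℝ (Fin d))) [IsProbabilityMeasure κ],
      ∫⁻ x, ‖x‖ₑ ^ p ∂κ ≠ ∞ → ∀ u v : EuclideanSpace ℝ (Fin d),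
      cov[fun x => inner ℝ x u, fun x => inner ℝ x v; κ] = (Var[fun x => inner ℝ x (u + v); κ] -
        Var[fun x => inner ℝ x u; κ] - Var[fun x => inner ℝ x v; κ]) / 2 := fun κ _ hκ u v => by
    have := variance_fun_add (memLp_inner hp hκ u) (memLp_inner hp hκ v)
    simp only [inner_add_right]
    rw [this]
    ring
  ext a b
  have ha := hcov ρ hρ (EuclideanSpace.single a 1) (EuclideanSpace.single b 1)
  have hb := hcov ρ' hρ' (EuclideanSpace.single a 1) (EuclideanSpace.single b 1)
  rw [hvar, hvar, hvar, ← hb] at ha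
  simp only [inner_single] at ha
  exact ha

lemma lintegral_enorm_rpow_ne_top_of_genericLaw (hN : N ≠ 0) {μ : Measure Ω}
    {C : Fin N → Ω → Matrix (Fin d) (Fin d) ℝ} (hC : ∀ i, Measurable (C i)) {s : ℝ}
    (h : ∫⁻ A, ‖A‖ₑ ^ s ∂(genericLaw μ C) ≠ ∞) (i : Fin N) : ∫⁻ ω, ‖C i ω‖ₑ ^ s ∂μ ≠ ∞ := by
  have h1 := mul_lintegral_genericLaw hN μ hC (f := fun A => ‖A‖ₑ ^ s) (by fun_prop)
  have h2 : ∑ i, ∫⁻ ω, ‖C i ω‖ₑ ^ s ∂μ ≠ ∞ := by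
    rw [← h1]
    finiteness
  exact ENNReal.sum_ne_top.1 h2 i (Finset.mem_univ i)

lemma mul_integral_genericLaw (hN : N ≠ 0) (μ : Measure Ω)
    {C : Fin N → Ω → Matrix (Fin d) (Fin d) ℝ} (hC : ∀ i, Measurable (C i))
    {f : Matrix (Fin d) (Fin d) ℝ → ℝ} (hf : Measurable f)
    (hint : ∀ i, Integrable (fun ω => f (C i ω)) μ) :
    N * ∫ A, f A ∂(genericLaw μ C) = ∑ i, ∫ ω, f (C i ω) ∂μ := by
  rw [genericLaw, integral_smul_measure, integral_finsetSum_measure]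
  · rw [ENNReal.toReal_inv, ENNReal.toReal_natCast, smul_eq_mul, ← mul_assoc,
      mul_inv_cancel₀ (by simpa), one_mul]
    exact Finset.sum_congr rfl fun i _ =>
      integral_map (hC i).aemeasurable hf.aestronglyMeasurable
  · exact fun i _ => (integrable_map_measure hf.aestronglyMeasurable (hC i).aemeasurable).2 (hint i)

lemma enorm_entry_le (A : Matrix (Fin d) (Fin d) ℝ) (a b : Fin d) : ‖A a b‖ₑ ≤ ‖A‖ₑ := by
  have h1 : A a b = act A (EuclideanSpace.single b 1) a := by simp [act]
  have h2 := norm_act_le A (EuclideanSpace.single b 1)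
  rw [PiLp.norm_single, norm_one, mul_one] at h2
  rw [h1, ← ofReal_norm, ← ofReal_norm]
  exact ENNReal.ofReal_le_ofReal ((PiLp.norm_apply_le _ a).trans h2)

lemma measurable_entry (a b : Fin d) :
    Measurable fun A : Matrix (Fin d) (Fin d) ℝ => A a b :=
  (measurable_pi_apply b).comp (measurable_pi_apply (X := fun _ => Fin d → ℝ) a)

lemma integrable_entry {μ : Measure Ω} [IsProbabilityMeasure μ]
    {A : Ω → Matrix (Fin d) (Fin d) ℝ} (hA : Measurable A) {p : ℝ} (hp : 1 ≤ p)
    (h : ∫⁻ ω, ‖A ω‖ₑ ^ p ∂μ ≠ ∞) (a b : Fin d) : Integrable (fun ω => A ω a b) μ := by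
  refine ⟨((measurable_entry a b).comp hA).aestronglyMeasurable, ?_⟩
  have := lintegral_rpow_ne_top_of_le zero_le_one hp h
  simp only [ENNReal.rpow_one] at this
  exact (lintegral_mono fun ω => enorm_entry_le (A ω) a b).trans_lt this.lt_top

lemma memLp_entry {μ : Measure Ω} [IsProbabilityMeasure μ]
    {A : Ω → Matrix (Fin d) (Fin d) ℝ} (hA : Measurable A)
    (h : ∫⁻ ω, ‖A ω‖ₑ ^ (2 : ℝ) ∂μ ≠ ∞) (a b : Fin d) : MemLp (fun ω => A ω a b) 2 μ := by
  have hm : Measurable fun ω => A ω a b := (measurable_entry a b).comp hA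
  refine (memLp_two_iff_integrable_sq hm.aestronglyMeasurable).2
    ⟨(hm.pow_const 2).aestronglyMeasurable, ?_⟩
  refine lt_of_le_of_lt (lintegral_mono fun ω => ?_) h.lt_top
  rw [enorm_pow, ← ENNReal.rpow_natCast]
  exact ENNReal.rpow_le_rpow (enorm_entry_le _ _ _) (by norm_num)

lemma act_apply (A : Matrix (Fin d) (Fin d) ℝ) (x : EuclideanSpace ℝ (Fin d)) (a : Fin d) :
    act A x a = ∑ b, A a b * x b := by
  simp [act, Matrix.mulVec, dotProduct]

lemma memLp_sum_act_apply {μ : Measure Ω} [IsProbabilityMeasure μ]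
    {C : Fin N → Ω → Matrix (Fin d) (Fin d) ℝ} (hC : ∀ i, Measurable (C i))
    (h : ∀ i, ∫⁻ ω, ‖C i ω‖ₑ ^ (2 : ℝ) ∂μ ≠ ∞) (r : EuclideanSpace ℝ (Fin d)) (a : Fin d) :
    MemLp (fun ω => (∑ i, act (C i ω) r) a) 2 μ := by
  simp only [WithLp.ofLp_sum, Finset.sum_apply, act_apply]
  exact memLp_finsetSum _ fun i _ => memLp_finsetSum _ fun b _ =>
    (memLp_entry (hC i) (h i) a b).mul_const (r b)

/-- The many-to-one formula turns `E ∑ C_i r` into `N E[C] r`, which is `r` by hypothesis. -/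
lemma integral_inner_sum_act (hN : N ≠ 0) {μ : Measure Ω} [IsProbabilityMeasure μ]
    {C : Fin N → Ω → Matrix (Fin d) (Fin d) ℝ} (hC : ∀ i, Measurable (C i)) {p : ℝ} (hp : 1 ≤ p)
    (h : ∀ i, ∫⁻ ω, ‖C i ω‖ₑ ^ p ∂μ ≠ ∞) {r : EuclideanSpace ℝ (Fin d)}
    (hr : EigenvalueEq μ C r) (u : EuclideanSpace ℝ (Fin d)) :
    ∫ ω, inner ℝ (∑ i, act (C i ω) r) u ∂μ = inner ℝ r u := by
  have hint : ∀ i a b, Integrable (fun ω => C i ω a b) μ := fun i a b =>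
    integrable_entry (hC i) hp (h i) a b
  have hra : ∀ a, r a = ∑ b, (∑ i, ∫ ω, C i ω a b ∂μ) * r b := fun a => by
    have h1 : r a = ((N : ℝ) • act (meanMatrix (genericLaw μ C)) r) a := congrArg (· a) hr
    rw [h1, PiLp.smul_apply, act_apply, smul_eq_mul, Finset.mul_sum]
    refine Finset.sum_congr rfl fun b _ => ?_
    rw [← mul_integral_genericLaw hN μ hC (measurable_entry a b) fun i => hint i a b, meanMatrix,
      Matrix.of_apply, mul_assoc]
  have hexp : ∀ ω, inner ℝ (∑ i, act (C i ω) r) u = ∑ a, ∑ b, ∑ i, C i ω a b * (r b * u a) := by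
    intro ω
    simp only [PiLp.inner_apply, WithLp.ofLp_sum, Finset.sum_apply, act_apply, RCLike.inner_apply,
      conj_trivial]
    refine Finset.sum_congr rfl fun a _ => ?_
    rw [Finset.sum_comm, Finset.mul_sum]
    refine Finset.sum_congr rfl fun b _ => ?_
    rw [Finset.mul_sum]
    exact Finset.sum_congr rfl fun i _ => by ring
  simp only [hexp]
  rw [integral_finsetSum _ fun a _ => integrable_finsetSum _ fun b _ => integrable_finsetSum _
    fun i _ => (hint i a b).mul_const _]
  simp only [PiLp.inner_apply, RCLike.inner_apply, conj_trivial]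
  refine Finset.sum_congr rfl fun a _ => ?_
  rw [integral_finsetSum _ fun b _ => integrable_finsetSum _ fun i _ => (hint i a b).mul_const _,
    hra a, Finset.mul_sum]
  refine Finset.sum_congr rfl fun b _ => ?_
  rw [integral_finsetSum _ fun i _ => (hint i a b).mul_const _, Finset.sum_mul, Finset.mul_sum]
  refine Finset.sum_congr rfl fun i _ => ?_
  rw [integral_mul_const]
  ring

lemma integral_transform_inner_pow (μ : Measure Ω) [IsProbabilityMeasure μ]
    {C : Fin N → Ω → Matrix (Fin d) (Fin d) ℝ} (hC : ∀ i, Measurable (C i))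
    (ρ : Measure (EuclideanSpace ℝ (Fin d))) [IsProbabilityMeasure ρ] {p : ℝ}
    (h : ∫⁻ x, ‖x‖ₑ ^ p ∂(transform μ C ρ) ≠ ∞) {m : ℕ} (hm : (m : ℝ) ≤ p)
    (u : EuclideanSpace ℝ (Fin d)) :
    ∫ x, inner ℝ x u ^ m ∂(transform μ C ρ) = ∫ ω, ∫ x, (∑ i, inner ℝ (x i) (act (C i ω)ᵀ u)) ^ m
      ∂(Measure.pi fun _ : Fin N => ρ) ∂μ := by
  have := isProbabilityMeasure_transform μ hC ρ
  have hint := integrable_inner_pow _ h hm u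
  have hmeas : Measurable fun x : EuclideanSpace ℝ (Fin d) => inner ℝ x u ^ m := by fun_prop
  rw [transform, integrable_map_measure hmeas.aestronglyMeasurable
    (measurable_sum_act hC).aemeasurable] at hint
  rw [transform, integral_map (measurable_sum_act hC).aemeasurable hmeas.aestronglyMeasurable]
  refine (integral_prod _ hint).trans ?_
  simp only [Function.comp_apply, sum_inner, inner_act]

lemma integral_pi_sum_inner {ρ : Measure (EuclideanSpace ℝ (Fin d))} [IsProbabilityMeasure ρ]
    (h : Integrable id ρ) (v : Fin N → EuclideanSpace ℝ (Fin d)) :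
    ∫ x, ∑ i, inner ℝ (x i) (v i) ∂(Measure.pi fun _ : Fin N => ρ) =
      ∑ i, inner ℝ (∫ x, x ∂ρ) (v i) := by
  have hint : ∀ i, Integrable (fun x => inner ℝ x (v i)) ρ := fun i => h.inner_const (v i)
  have hint' : ∀ i, Integrable (fun x : Fin N → EuclideanSpace ℝ (Fin d) => inner ℝ (x i) (v i))
      (Measure.pi fun _ : Fin N => ρ) := fun i =>
    (measurePreserving_eval (fun _ : Fin N => ρ) i).integrable_comp_of_integrable (hint i)
  rw [integral_finsetSum _ fun i _ => hint' i]
  refine Finset.sum_congr rfl fun i _ => ?_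
  rw [← integral_inner_eq h]
  exact integral_comp_eval (μ := fun _ : Fin N => ρ) (i := i) (hint i).aestronglyMeasurable

/-- Variances of independent summands add; the squared mean is restored afterwards. -/
lemma integral_pi_sum_inner_sq {ρ : Measure (EuclideanSpace ℝ (Fin d))} [IsProbabilityMeasure ρ]
    {p : ℝ} (hp : 2 ≤ p) (h : ∫⁻ x, ‖x‖ₑ ^ p ∂ρ ≠ ∞) (v : Fin N → EuclideanSpace ℝ (Fin d)) :
    ∫ x, (∑ i, inner ℝ (x i) (v i)) ^ 2 ∂(Measure.pi fun _ : Fin N => ρ) =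
      ∑ i, ∑ a, ∑ b, v i a * v i b * covMatrix ρ id a b +
        (∑ i, inner ℝ (∫ x, x ∂ρ) (v i)) ^ 2 := by
  have hi := integrable_id_of_lintegral_rpow (by linarith) h
  have hL : ∀ i, MemLp (fun x : Fin N → EuclideanSpace ℝ (Fin d) => inner ℝ (x i) (v i)) 2
      (Measure.pi fun _ : Fin N => ρ) := fun i =>
    (memLp_inner hp h (v i)).comp_measurePreserving (measurePreserving_eval (fun _ : Fin N => ρ) i)
  have h1 := variance_sum_pi (μ := fun _ : Fin N => ρ) (X := fun i x => inner ℝ x (v i))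
    fun i => memLp_inner hp h (v i)
  rw [variance_eq_sub (memLp_finsetSum' _ fun i _ => hL i)] at h1
  simp only [Pi.pow_apply, Finset.sum_apply, integral_pi_sum_inner hi] at h1
  rw [sub_eq_iff_eq_add] at h1
  rw [h1]
  congr 1
  exact Finset.sum_congr rfl fun i _ => variance_inner ρ (X := id) (memLp_coord hp h) (v i)

lemma sum_mul_mul_eq_dotProduct (S : Matrix (Fin d) (Fin d) ℝ) (x : Fin d → ℝ) :
    ∑ a, ∑ b, x a * x b * S a b = x ⬝ᵥ S *ᵥ x := by
  simp only [Matrix.mulVec, dotProduct, Finset.mul_sum]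
  exact Finset.sum_congr rfl fun a _ => Finset.sum_congr rfl fun b _ => by ring

lemma sum_act_transpose (S A : Matrix (Fin d) (Fin d) ℝ) (u : EuclideanSpace ℝ (Fin d)) :
    ∑ a, ∑ b, act Aᵀ u a * act Aᵀ u b * S a b = ∑ a, ∑ b, u a * u b * (A * S * Aᵀ) a b := by
  rw [sum_mul_mul_eq_dotProduct, sum_mul_mul_eq_dotProduct]
  simp only [act]
  rw [Matrix.mulVec_transpose, ← Matrix.dotProduct_mulVec, ← Matrix.mulVec_transpose]
  simp only [Matrix.mulVec_mulVec, Matrix.mul_assoc]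

/-- The smoothing transform preserves the expectation `r`. -/
lemma momentsMatch_two_transform (hN : N ≠ 0) (μ : Measure Ω) [IsProbabilityMeasure μ]
    {C : Fin N → Ω → Matrix (Fin d) (Fin d) ℝ} (hC : ∀ i, Measurable (C i)) {p : ℝ} (hp : 1 ≤ p)
    (hCp : ∀ i, ∫⁻ ω, ‖C i ω‖ₑ ^ p ∂μ ≠ ∞) {r : EuclideanSpace ℝ (Fin d)}
    (hr : EigenvalueEq μ C r) {ρ : Measure (EuclideanSpace ℝ (Fin d))} [IsProbabilityMeasure ρ]
    (h : ∫⁻ x, ‖x‖ₑ ^ p ∂ρ ≠ ∞) (hρ : ∫ x, x ∂ρ = r) : MomentsMatch 2 ρ (transform μ C ρ) := by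
  have := isProbabilityMeasure_transform μ hC ρ
  have hi := integrable_id_of_lintegral_rpow hp h
  refine momentsMatch_two fun u => ?_
  have h1 := integral_transform_inner_pow μ hC ρ (lintegral_transform_ne_top μ hC hp hCp ρ h)
    (m := 1) (by exact_mod_cast hp) u
  simp only [pow_one, integral_pi_sum_inner hi, hρ] at h1
  simp only [← inner_act, ← sum_inner] at h1
  rw [h1, integral_inner_sum_act hN hC hp hCp hr, integral_inner_eq hi, hρ]

/-- The smoothing transform preserves the expectation `r` and the covariance matrix `Σ`. -/
lemma momentsMatch_three_transform (hN : N ≠ 0) (μ : Measure Ω) [IsProbabilityMeasure μ]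
    {C : Fin N → Ω → Matrix (Fin d) (Fin d) ℝ} (hC : ∀ i, Measurable (C i)) {p : ℝ} (hp : 2 ≤ p)
    (hCp : ∀ i, ∫⁻ ω, ‖C i ω‖ₑ ^ p ∂μ ≠ ∞) {r : EuclideanSpace ℝ (Fin d)}
    (hr : EigenvalueEq μ C r) {S : Matrix (Fin d) (Fin d) ℝ} (hS : CovarianceEq μ C r S)
    {ρ : Measure (EuclideanSpace ℝ (Fin d))} [IsProbabilityMeasure ρ]
    (h : ∫⁻ x, ‖x‖ₑ ^ p ∂ρ ≠ ∞) (hρ : ∫ x, x ∂ρ = r) (hρS : covMatrix ρ id = S) :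
    MomentsMatch 3 ρ (transform μ C ρ) := by
  have := isProbabilityMeasure_transform μ hC ρ
  have hp1 : 1 ≤ p := by linarith
  have hi := integrable_id_of_lintegral_rpow hp1 h
  have h2 := momentsMatch_two_transform hN μ hC hp1 hCp hr h hρ
  refine momentsMatch_three (fun u => by simpa using h2 1 one_lt_two u) fun u => ?_
  have hC2 : ∀ i, ∫⁻ ω, ‖C i ω‖ₑ ^ (2 : ℝ) ∂μ ≠ ∞ := fun i =>
    lintegral_rpow_ne_top_of_le zero_le_two hp (hCp i)
  have hmSC : Measurable fun A : Matrix (Fin d) (Fin d) ℝ => A * S * Aᵀ :=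
    (Continuous.mul (continuous_id.mul continuous_const) continuous_id.matrix_transpose).measurable
  have hSC : ∀ i a b, Integrable (fun ω => (C i ω * S * (C i ω)ᵀ) a b) μ := fun i a b => by
    refine integrable_entry (p := 1) (hmSC.comp (hC i)) le_rfl ?_ a b
    refine ne_top_of_le_ne_top (b := ∫⁻ ω, ‖S‖ₑ * ‖C i ω‖ₑ ^ (2 : ℝ) ∂μ) ?_
      (lintegral_mono fun ω => ?_)
    · have := hC i
      rw [lintegral_const_mul _ (by fun_prop)]
      exact ENNReal.mul_ne_top enorm_ne_top (hC2 i)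
    · rw [ENNReal.rpow_one, ENNReal.rpow_two]
      calc _ ≤ ‖C i ω‖ₑ * ‖S‖ₑ * ‖(C i ω)ᵀ‖ₑ :=
            (enorm_matrix_mul_le _ _).trans (by gcongr; exact enorm_matrix_mul_le _ _)
        _ = _ := by rw [enorm_transpose]; ring
  have hY := memLp_sum_act_apply hC hC2 r
  have hYu : MemLp (fun ω => inner ℝ (∑ i, act (C i ω) r) u) 2 μ := by
    simp only [PiLp.inner_apply, RCLike.inner_apply, conj_trivial]
    exact memLp_finsetSum _ fun a _ => (hY a).const_mul (u a)
  have hvar := variance_eq_sub hYu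
  rw [variance_inner μ hY, integral_inner_sum_act hN hC hp1 hCp hr] at hvar
  simp only [Pi.pow_apply] at hvar
  have hsq : ∫ ω, inner ℝ (∑ i, act (C i ω) r) u ^ 2 ∂μ = (∑ a, ∑ b, u a * u b *
      covMatrix μ (fun ω => ∑ k, act (C k ω) r) a b) + inner ℝ r u ^ 2 := by linarith
  have hSab : ∀ a b, S a b = ∑ i, ∫ ω, (C i ω * S * (C i ω)ᵀ) a b ∂μ +
      covMatrix μ (fun ω => ∑ k, act (C k ω) r) a b := fun a b => by
    have h1 := congrFun (congrFun hS a) b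
    rw [← mul_integral_genericLaw hN μ hC (f := fun A => (A * S * Aᵀ) a b)
      ((measurable_entry a b).comp hmSC) fun i => hSC i a b]
    exact h1
  have hint : ∀ i, Integrable
      (fun ω => ∑ a, ∑ b, u a * u b * (C i ω * S * (C i ω)ᵀ) a b) μ := fun i =>
    integrable_finsetSum _ fun a _ => integrable_finsetSum _ fun b _ => (hSC i a b).const_mul _
  -- Law of total variance: given the matrices, the sum has covariance `∑ C_i Σ C_iᵀ` and mean `∑
  -- C_i r`. The two contributions are the two terms of `CovarianceEq`.
  have h1 := integral_transform_inner_pow μ hC ρ (lintegral_transform_ne_top μ hC hp1 hCp ρ h)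
    (m := 2) (by exact_mod_cast hp) u
  simp only [integral_pi_sum_inner_sq hp h, hρ, hρS, sum_act_transpose] at h1
  simp only [← inner_act, ← sum_inner] at h1
  rw [h1, integral_inner_sq_eq hp h, integral_inner_eq hi, hρ, hρS,
    integral_add (integrable_finsetSum _ fun i _ => hint i) hYu.integrable_sq,
    hsq, ← add_assoc, integral_finsetSum _ fun i _ => hint i]
  congr 1
  simp only [integral_finsetSum _ (fun a _ => integrable_finsetSum _ fun b _ =>
    (hSC _ a b).const_mul _)]
  simp only [integral_finsetSum _ (fun b _ => (hSC _ _ b).const_mul _), integral_const_mul]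
  simp only [hSab, mul_add, Finset.mul_sum, Finset.sum_add_distrib]
  congr 1
  exact (Finset.sum_congr rfl fun b _ => Finset.sum_comm).trans Finset.sum_comm

/-! ### Choice of exponents and starting laws. -/

lemma exists_ofReal_between {a b : ℝ≥0∞} (h : a < b) :
    ∃ p : ℝ, 0 < p ∧ a < ENNReal.ofReal p ∧ ENNReal.ofReal p < b := by
  obtain ⟨t, h1, h2⟩ := exists_between h
  have ht : ENNReal.ofReal t.toReal = t := ENNReal.ofReal_toReal (h2.trans_le le_top).ne
  refine ⟨t.toReal, ?_, by rwa [ht], by rwa [ht]⟩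
  exact ENNReal.toReal_pos (zero_le.trans_lt h1).ne' (h2.trans_le le_top).ne

lemma lintegral_enorm_rpow_matrix_ne_top (hN : N ≠ 0) {μ : Measure Ω} [IsProbabilityMeasure μ]
    {C : Fin N → Ω → Matrix (Fin d) (Fin d) ℝ} (hC : ∀ i, Measurable (C i)) {s : ℝ} (hs : 0 ≤ s)
    (h : ENNReal.ofReal s < beta μ C) (i : Fin N) : ∫⁻ ω, ‖C i ω‖ₑ ^ s ∂μ ≠ ∞ :=
  lintegral_enorm_rpow_ne_top_of_genericLaw hN hC
    (lintegral_enorm_rpow_genericLaw_ne_top hN hC hs (h.trans_le (beta_le_sInfty μ C))) i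

lemma IsSolution.lintegral_ne_top {μ : Measure Ω} {C : Fin N → Ω → Matrix (Fin d) (Fin d) ℝ}
    {r : EuclideanSpace ℝ (Fin d)} {ρ : Measure (EuclideanSpace ℝ (Fin d))}
    (h : IsSolution μ C r ρ) {p : ℝ} (hp : 0 < p) (hpβ : ENNReal.ofReal p < beta μ C) :
    ∫⁻ x, ‖x‖ₑ ^ p ∂ρ ≠ ∞ :=
  (h.moment p hp (lt_min (hpβ.trans_le (beta_le_sInfty μ C)) hpβ)).ne

lemma IsSolution.momentsMatch_two {μ : Measure Ω} {C : Fin N → Ω → Matrix (Fin d) (Fin d) ℝ}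
    {r : EuclideanSpace ℝ (Fin d)} {ρ ρ' : Measure (EuclideanSpace ℝ (Fin d))}
    (h : IsSolution μ C r ρ) (h' : IsSolution μ C r ρ') : MomentsMatch 2 ρ ρ' := by
  have := h.isProbabilityMeasure
  have := h'.isProbabilityMeasure
  refine SmoothingTransform.momentsMatch_two fun u => ?_
  rw [integral_inner_eq h.integrable, integral_inner_eq h'.integrable, h.mean, h'.mean]

lemma IsSolution.eq_of_lt_two (hN : N ≠ 0) {μ : Measure Ω} [IsProbabilityMeasure μ]
    {C : Fin N → Ω → Matrix (Fin d) (Fin d) ℝ} (hC : ∀ i, Measurable (C i))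
    (hαβ : ∃ s : ℝ, alpha μ C < ENNReal.ofReal s ∧ ENNReal.ofReal s < beta μ C ∧ m μ C s < 1)
    (hα : alpha μ C < 2) {r : EuclideanSpace ℝ (Fin d)}
    {ρ ρ' : Measure (EuclideanSpace ℝ (Fin d))} (h : IsSolution μ C r ρ)
    (h' : IsSolution μ C r ρ') : ρ = ρ' := by
  have := h.isProbabilityMeasure
  have := h'.isProbabilityMeasure
  obtain ⟨s, hs1, hs2, -⟩ := id hαβ
  obtain ⟨p, hp, hαp, hpβ⟩ := exists_ofReal_between (lt_min hα (hs1.trans hs2))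
  obtain ⟨hp2, hpβ⟩ := lt_min_iff.1 hpβ
  have hp2 : p < 2 := by simpa using (ENNReal.ofReal_lt_iff_lt_toReal hp.le (by simp)).1 hp2
  have hsum := tsum_scaledMoment_ne_top hN hC hαβ hαp hpβ
  -- Here `α` and `β` may both lie below `1`; for `p ≤ 1` agreement of total mass suffices,
  -- otherwise the common mean is used.
  rcases le_total p 1 with h1 | h1
  · exact eq_of_fixed_of_momentsMatch hN μ hC one_ne_zero (by norm_num) (p := p)
      (by push_cast; linarith) (by exact_mod_cast h1) hsum h.fixed h'.fixed
      (h.lintegral_ne_top hp hpβ) (h'.lintegral_ne_top hp hpβ) (momentsMatch_one ρ ρ')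
  · exact eq_of_fixed_of_momentsMatch hN μ hC two_ne_zero (by norm_num) (p := p)
      (by push_cast; linarith) (by push_cast; linarith) hsum h.fixed h'.fixed
      (h.lintegral_ne_top hp hpβ) (h'.lintegral_ne_top hp hpβ) (h.momentsMatch_two h')

lemma exists_isSolution_of_momentsMatch (hN : N ≠ 0) {μ : Measure Ω} [IsProbabilityMeasure μ]
    {C : Fin N → Ω → Matrix (Fin d) (Fin d) ℝ} (hC : ∀ i, Measurable (C i))
    (hαβ : ∃ s : ℝ, alpha μ C < ENNReal.ofReal s ∧ ENNReal.ofReal s < beta μ C ∧ m μ C s < 1)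
    {j : ℕ} (hj : 2 ≤ j) (hj3 : j ≤ 3) {p : ℝ} (hp : (j : ℝ) - 1 < p) (hpj : p ≤ j)
    (hαp : alpha μ C < ENNReal.ofReal p) (hpβ : ENNReal.ofReal p < beta μ C)
    {ρ₀ : Measure (EuclideanSpace ℝ (Fin d))} [IsProbabilityMeasure ρ₀]
    (h₀ : ∀ s : ℝ, 0 ≤ s → ∫⁻ x, ‖x‖ₑ ^ s ∂ρ₀ ≠ ∞) {r : EuclideanSpace ℝ (Fin d)}
    (hr : ∫ x, x ∂ρ₀ = r) (hm : MomentsMatch j ρ₀ (transform μ C ρ₀)) :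
    ∃ ρ, IsSolution μ C r ρ ∧ MomentsMatch j ρ₀ ρ := by
  have hp1 : 1 < p := by
    have : (2 : ℝ) ≤ j := by exact_mod_cast hj
    linarith
  obtain ⟨ρ, hprob, hfix, ⟨c, hc, hφ⟩, hmom⟩ := exists_fixed_of_momentsMatch hN μ hC hj hj3 hp hpj
    (lintegral_enorm_rpow_matrix_ne_top hN hC (by linarith) hpβ)
    (tsum_scaledMoment_ne_top hN hC hαβ hαp hpβ) ρ₀ h₀ hm
  -- Summability is available only above `α`; moments of order below `p` follow afterwards by
  -- comparison with order `p`.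
  have hfin : ∀ s, p ≤ s → ENNReal.ofReal s < beta μ C → ∫⁻ x, ‖x‖ₑ ^ s ∂ρ ≠ ∞ :=
    fun s hps hs => hmom s (by linarith)
      (lintegral_enorm_rpow_matrix_ne_top hN hC (by linarith) hs)
      (tsum_scaledMoment_ne_top hN hC hαβ (hαp.trans_le (ENNReal.ofReal_le_ofReal hps)) hs)
  have hpfin := hfin p le_rfl hpβ
  have hmatch : MomentsMatch j ρ₀ ρ := momentsMatch_of_enorm_charFun_sub_le (by omega) hj3 hp hpj
    (h₀ p (by linarith)) hpfin hc hφ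
  have hint := integrable_id_of_lintegral_rpow hp1.le hpfin
  refine ⟨ρ, ⟨hprob, hfix, hint, ?_, fun s hs hsβ => ?_⟩, hmatch⟩
  · rw [← hr]
    exact (mean_eq_of_momentsMatch
      (integrable_id_of_lintegral_rpow le_rfl (h₀ 1 zero_le_one)) hint (hmatch.mono hj)).symm
  · refine (lintegral_rpow_ne_top_of_le hs.le (le_max_left s p)
      (hfin (max s p) (le_max_right s p) ?_)).lt_top
    rcases max_choice s p with h | h <;> rw [h]
    · exact (lt_min_iff.1 hsβ).2
    · exact hpβ

lemma transform_dirac_zero (μ : Measure Ω) [IsProbabilityMeasure μ]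
    {C : Fin N → Ω → Matrix (Fin d) (Fin d) ℝ} (hC : ∀ i, Measurable (C i)) :
    transform μ C (Measure.dirac 0) = Measure.dirac 0 := by
  have := isProbabilityMeasure_transform μ hC (Measure.dirac (0 : EuclideanSpace ℝ (Fin d)))
  refine Measure.ext_of_charFun (funext fun u => ?_)
  rw [charFun_transform μ hC]
  simp [charFun_apply]

lemma isSolution_dirac_zero (μ : Measure Ω) [IsProbabilityMeasure μ]
    {C : Fin N → Ω → Matrix (Fin d) (Fin d) ℝ} (hC : ∀ i, Measurable (C i)) :
    IsSolution μ C 0 (Measure.dirac 0) where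
  isProbabilityMeasure := inferInstance
  fixed := transform_dirac_zero μ hC
  integrable := integrable_dirac (by simp)
  mean := by simp
  moment s hs _ := by
    rw [lintegral_dirac' _ (by fun_prop)]
    simp [hs]

/-- The bound `β > 1` leaves room for an exponent in `(1, 2)` between `α` and `β`. The iteration
starts from the Dirac mass at `r`, whose mean the transform preserves. -/
lemma exists_isSolution_of_ne_zero (hN : N ≠ 0) {μ : Measure Ω} [IsProbabilityMeasure μ]
    {C : Fin N → Ω → Matrix (Fin d) (Fin d) ℝ} (hC : ∀ i, Measurable (C i))
    (hαβ : ∃ s : ℝ, alpha μ C < ENNReal.ofReal s ∧ ENNReal.ofReal s < beta μ C ∧ m μ C s < 1)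
    (hα : alpha μ C < 2) (hβ : 1 < beta μ C) {r : EuclideanSpace ℝ (Fin d)}
    (hr : EigenvalueEq μ C r) : ∃ ρ, IsSolution μ C r ρ := by
  obtain ⟨s, hs1, hs2, -⟩ := id hαβ
  obtain ⟨p, hp, h1, h2⟩ := exists_ofReal_between
    (max_lt (lt_min hα (hs1.trans hs2)) (lt_min ENNReal.one_lt_two hβ))
  obtain ⟨hαp, hp1⟩ := max_lt_iff.1 h1
  obtain ⟨hp2, hpβ⟩ := lt_min_iff.1 h2
  have hp2 : p < 2 := by simpa using (ENNReal.ofReal_lt_iff_lt_toReal hp.le (by simp)).1 hp2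
  have hp1 : 1 < p := ENNReal.one_lt_ofReal.1 hp1
  have h₀ : ∀ s : ℝ, 0 ≤ s → ∫⁻ x, ‖x‖ₑ ^ s ∂(Measure.dirac r) ≠ ∞ := fun s hs => by
    rw [lintegral_dirac' _ (by fun_prop)]
    exact ENNReal.rpow_ne_top_of_nonneg hs enorm_ne_top
  have hmean : ∫ x, x ∂(Measure.dirac r) = r := integral_dirac _ r
  obtain ⟨ρ, hρ, -⟩ := exists_isSolution_of_momentsMatch hN hC hαβ le_rfl (by norm_num) (p := p)
    (by push_cast; linarith) (by push_cast; linarith) hαp hpβ h₀ hmean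
    (momentsMatch_two_transform hN μ hC hp1.le
      (lintegral_enorm_rpow_matrix_ne_top hN hC hp.le hpβ) hr (h₀ p hp.le) hmean)
  exact ⟨ρ, hρ⟩

lemma existsUnique_isSolution_covMatrix (hN : N ≠ 0) {μ : Measure Ω} [IsProbabilityMeasure μ]
    {C : Fin N → Ω → Matrix (Fin d) (Fin d) ℝ} (hC : ∀ i, Measurable (C i))
    (hαβ : ∃ s : ℝ, alpha μ C < ENNReal.ofReal s ∧ ENNReal.ofReal s < beta μ C ∧ m μ C s < 1)
    (hα : alpha μ C = 2) {r : EuclideanSpace ℝ (Fin d)} (hr : EigenvalueEq μ C r)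
    {S : Matrix (Fin d) (Fin d) ℝ} (hS : S.PosSemidef) (hCS : CovarianceEq μ C r S) :
    ∃! ρ : Measure (EuclideanSpace ℝ (Fin d)), IsSolution μ C r ρ ∧ covMatrix ρ id = S := by
  obtain ⟨s, hs1, hs2, -⟩ := id hαβ
  obtain ⟨p, hp, hαp, hp2⟩ := exists_ofReal_between (a := alpha μ C) (b := min 3 (beta μ C))
    (lt_min (by rw [hα]; norm_num) (hs1.trans hs2))
  obtain ⟨hp3, hpβ⟩ := lt_min_iff.1 hp2
  have hp3 : p < 3 := by simpa using (ENNReal.ofReal_lt_iff_lt_toReal hp.le (by simp)).1 hp3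
  have hp2 : 2 < p := by
    rw [hα] at hαp
    simpa using (ENNReal.lt_ofReal_iff_toReal_lt (by simp)).1 hαp
  have hCp := lintegral_enorm_rpow_matrix_ne_top hN hC hp.le hpβ
  -- The Gaussian law serves as starting point: it has the prescribed mean and covariance and
  -- moments of all orders.
  have h₀ : ∀ s : ℝ, 0 ≤ s → ∫⁻ x, ‖x‖ₑ ^ s ∂(multivariateGaussian r S) ≠ ∞ := fun s hs => by
    rcases hs.eq_or_lt with rfl | hs
    · simp
    · have := (IsGaussian.memLp_id (multivariateGaussian r S) (ENNReal.ofReal s)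
        ENNReal.ofReal_ne_top)
      have := lintegral_rpow_enorm_lt_top_of_eLpNorm_lt_top (by simpa) ENNReal.ofReal_ne_top this.2
      rw [ENNReal.toReal_ofReal hs.le] at this
      exact this.ne
  have hmean : ∫ x, x ∂(multivariateGaussian r S) = r := integral_id_multivariateGaussian
  have hcov : covMatrix (multivariateGaussian r S) id = S := by
    ext a b
    exact covariance_eval_multivariateGaussian hS a b
  obtain ⟨ρ, hρ, hmatch⟩ := exists_isSolution_of_momentsMatch hN hC hαβ (j := 3) (by norm_num)
    le_rfl (p := p) (by push_cast; linarith) (by push_cast; linarith) hαp hpβ h₀ hmean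
    (momentsMatch_three_transform hN μ hC hp2.le hCp hr hCS (h₀ p hp.le) hmean hcov)
  have := hρ.isProbabilityMeasure
  have hρS : covMatrix ρ id = S := by
    rw [← hcov]
    exact (covMatrix_eq_of_momentsMatch hp2.le (h₀ p hp.le) (hρ.lintegral_ne_top hp hpβ)
      hmatch).symm
  refine ⟨ρ, ⟨hρ, hρS⟩, fun ρ' ⟨hρ', hρS'⟩ => ?_⟩
  have := hρ'.isProbabilityMeasure
  have hfin := hρ.lintegral_ne_top hp hpβ
  have hfin' := hρ'.lintegral_ne_top hp hpβ
  have h1 : ∀ u, ∫ x, inner ℝ x u ∂ρ' = ∫ x, inner ℝ x u ∂ρ := fun u => by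
    rw [integral_inner_eq hρ'.integrable, integral_inner_eq hρ.integrable, hρ'.mean, hρ.mean]
  refine eq_of_fixed_of_momentsMatch hN μ hC three_ne_zero le_rfl (p := p)
    (by push_cast; linarith) (by push_cast; linarith)
    (tsum_scaledMoment_ne_top hN hC hαβ hαp hpβ) hρ'.fixed hρ.fixed hfin' hfin
    (momentsMatch_three h1 fun u => ?_)
  rw [integral_inner_sq_eq hp2.le hfin', integral_inner_sq_eq hp2.le hfin, hρS, hρS', h1]

end SmoothingTransform

end

open SmoothingTransform in
theorem proposition2p1 {d N : ℕ} (hN : 1 < N) {Ω : Type*} [MeasurableSpace Ω]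
    (μ : Measure Ω) [IsProbabilityMeasure μ]
    (C : Fin N → Ω → Matrix (Fin d) (Fin d) ℝ) (hC : ∀ i, Measurable (C i))
    (hαβ : ∃ s : ℝ, alpha μ C < ENNReal.ofReal s ∧ ENNReal.ofReal s < beta μ C ∧ m μ C s < 1)
    (r : EuclideanSpace ℝ (Fin d)) (hr : EigenvalueEq μ C r) (hβ : r ≠ 0 → 1 < beta μ C) :
    (alpha μ C < min 2 (sInfty μ C) →
      (∃! ρ : Measure (EuclideanSpace ℝ (Fin d)), IsSolution μ C r ρ) ∧
        ∀ ρ : Measure (EuclideanSpace ℝ (Fin d)), IsSolution μ C r ρ →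
          (ρ = Measure.dirac 0 ↔ r = 0)) ∧
    (alpha μ C = 2 → alpha μ C < sInfty μ C →
      ∀ S : Matrix (Fin d) (Fin d) ℝ, S.PosDef → CovarianceEq μ C r S →
        ∃! ρ : Measure (EuclideanSpace ℝ (Fin d)),
          IsSolution μ C r ρ ∧ covMatrix ρ id = S) := by
  have hN0 : N ≠ 0 := by omega
  refine ⟨fun hα => ?_, fun hα _ S hS hCS =>
    existsUnique_isSolution_covMatrix hN0 hC hαβ hα hr hS.posSemidef hCS⟩
  have hα2 := (lt_min_iff.1 hα).1
  have huniq : ∀ ρ ρ', IsSolution μ C r ρ → IsSolution μ C r ρ' → ρ = ρ' := fun _ _ h h' =>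
    h.eq_of_lt_two hN0 hC hαβ hα2 h'
  obtain ⟨ρ, hρ⟩ : ∃ ρ, IsSolution μ C r ρ := by
    -- For `r = 0` the range `(α, β)` may contain no exponent above `1`, but the Dirac mass at `0`
    -- is a solution outright.
    by_cases h0 : r = 0
    · rw [h0]
      exact ⟨_, isSolution_dirac_zero μ hC⟩
    · exact exists_isSolution_of_ne_zero hN0 hC hαβ hα2 (hβ h0) hr
  refine ⟨⟨ρ, hρ, fun ρ' h => huniq ρ' ρ h hρ⟩, fun ρ' h => ⟨fun h0 => ?_, fun h0 => ?_⟩⟩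
  · rw [← h.mean, h0, integral_dirac]
  · rw [h0] at h huniq
    exact huniq ρ' _ h (isSolution_dirac_zero μ hC)
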